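/- Let $0<r\le 1$, let $(\Omega_i,\mathcal M_i,\mu_i)$ $(i=1,\dots,l)$ and $(\Xi_j,\mathcal M'_j,\nu_j)$ $(j=1,\dots,m)$ be $\sigma$-finite measure spaces, $\Omega=\prod_i\Omega_i$, $\Xi=\prod_j\Xi_j$, $\mu=\mu_1\otimes\cdots\otimes\mu_l$, $\nu=\nu_1\otimes\cdots\otimes\nu_m$, and let $P=(p_1,\dots,p_l)$, $Q=(q_1,\dots,q_m)$ with $1\le p_i,q_j<\infty$; $P'=(p_1',\dots,p_l')$ and $Q'$ denote the tuples of conjugate exponents. For exponents $1\le p_i\le\infty$ and a strictly positive measurable function $w$ on $\Omega$ (a weight), $L^P_w(\mu)$ is the space of measurable scalar functions $f$ on $\Omega$ (real or complex, modulo a.e. equality) for which $$\|f\|_{L^P_w(\mu)}:=\|fw\|_{L^P(\mu)}=\Big(\int_{\Omega_l}\cdots\Big(\int_{\Omega_2}\Big(\int_{\Omega_1}|f(x)|^{p_1}w(x)^{p_1}\,d\mu_1(x_1)\Big)^{p_2/p_1}d\mu_2(x_2)\Big)^{p_3/p_2}\cdots d\mu_l(x_l)\Big)^{1/p_l}$$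 is finite, where $L^\infty$-norms (essential suprema) replace the integral norms for infinite exponents. A linear operator $T:E\to F$ between normed spaces is $r$-nuclear if there are sequences $(x_n')$ in the dual $E'$ and $(y_n)$ in $F$ with $\sum_n\|x_n'\|^r\|y_n\|^r<\infty$ and $Tx=\sum_n\langle x,x_n'\rangle y_n$ in $F$ for all $x\in E$. Let $w,\widetilde w$ be weights on $\Omega,\Xi$ with $$w_P(\Omega):=\|1_\Omega\|_{L^P_w(\mu)}<\infty,\qquad \widetilde w^{-1}_{Q'}(\Xi):=\|1_\Xi\|_{L^{Q'}_{\widetilde w^{-1}}(\nu)}<\infty .$$ Then a linear operator $T:L^P_w(\mu)\to L^Q_{\widetilde w}(\nu)$ is $r$-nuclear if and only if there exist sequences $(g_n)$ in $L^Q_{\widetilde w}(\nu)$ and $(h_n)$ in $L^{P'}_{w^{-1}}(\mu)$ such that $\sum_{n=1}^\infty\|g_n\|^r_{L^Q_{\widetilde w}(\nu)}\|h_n\|^r_{L^{P'}_{w^{-1}}(\mu)}<\infty$ and, for all $f\in L^P_w(\mu)$, $$Tf(x)=\int_\Omega\Big(\sum_{n=1}^\infty g_n(x)h_n(y)\Big)f(y)\,d\mu(y)\qquad\text{for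 a.e. }x\in\Xi .$$ Here, for all sequences $(g_n)$ in $L^Q_{\widetilde w}(\nu)$ and $(h_n)$ in $L^{P'}_{w^{-1}}(\mu)$ satisfying this summability condition and all $f\in L^P_w(\mu)$, the right-hand side is well defined: for a.e. $x$, the series converges absolutely for a.e. $y$, and the integrand is integrable over $\Omega$. -/

import Mathlib

open MeasureTheory
open scoped ENNReal

universe u v

noncomputable section

/-- A weight on a measurable space: a strictly positive measurable real function. -/
structure Weight (X : Type*) [MeasurableSpace X] where
  toFun : X → ℝ
  pos' : ∀ x, 0 < toFun x
  measurable' : Measurable toFun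

namespace Weight

variable {X : Type*} [MeasurableSpace X]

instance : CoeFun (Weight X) (fun _ => X → ℝ) := ⟨Weight.toFun⟩

/-- The pointwise inverse of a weight. -/
instance : Inv (Weight X) :=
  ⟨fun w => ⟨fun x => (w x)⁻¹, fun x => inv_pos.2 (w.pos' x), w.measurable'.inv⟩⟩

end Weight

/-- The tuple of conjugate exponents `P' = (p₁', …, pₙ')`, where `1/p + 1/p' = 1`
(so that `1' = ∞`). -/
abbrev conjExponents {n : ℕ} (P : Fin n → ℝ≥0∞) : Fin n → ℝ≥0∞ := fun i => (P i).conjExponent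

instance instFactConjExponent (p : ℝ≥0∞) : Fact (1 ≤ p.conjExponent) :=
  ⟨by simp [ENNReal.conjExponent]⟩

/-- The (unweighted) mixed norm, with values in `[0, ∞]`, of a nonnegative function of `n`
variables: take the `L^{p₁}(μ₁)`-norm in the first variable, then the `L^{p₂}(μ₂)`-norm in the
second variable of the resulting function, and so on; the `L^{pₙ}(μₙ)`-norm in the last variable
is taken last. For finite exponents this is
`(∫ ⋯ (∫ (∫ f(x)^{p₁} dμ₁(x₁))^{p₂/p₁} dμ₂(x₂))^{p₃/p₂} ⋯ dμₙ(xₙ))^{1/pₙ}`;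
an infinite exponent stands for an essential supremum. -/
def mixedENorm : {n : ℕ} → {Ω : Fin n → Type u} → [∀ i, MeasurableSpace (Ω i)] →
    (∀ i, Measure (Ω i)) → (Fin n → ℝ≥0∞) → ((∀ i, Ω i) → ℝ≥0∞) → ℝ≥0∞
  | 0, _, _, _, _, f => f (fun i => i.elim0)
  | n + 1, _, _, μ, P, f =>
      mixedENorm (fun i : Fin n => μ i.succ) (fun i : Fin n => P i.succ)
        (fun y => eLpNorm (fun t => f (Fin.cons t y)) (P 0) (μ 0))

section MixedENorm

lemma measurable_eLpNorm_param {A B : Type*} [MeasurableSpace A] [MeasurableSpace B]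
    (μ : Measure B) [SigmaFinite μ] (p : ℝ≥0∞) {f : A → B → ℝ≥0∞}
    (hf : Measurable (Function.uncurry f)) : Measurable (fun a => eLpNorm (f a) p μ) := by
  rcases eq_or_ne p 0 with rfl | h0
  · simp
  rcases eq_or_ne p ∞ with rfl | ht
  · refine measurable_of_Iic fun c => ?_
    have h : (fun a => eLpNorm (f a) ∞ μ) ⁻¹' Set.Iic c
        = {a | μ (Prod.mk a ⁻¹' {z : A × B | c < Function.uncurry f z}) = 0} := by
      ext a
      simp only [Set.mem_preimage, Set.mem_Iic, Set.mem_ofPred_eq, eLpNorm_exponent_top,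
        eLpNormEssSup, enorm_eq_self]
      constructor
      · intro h
        have h2 : ∀ᵐ y ∂μ, f a y ≤ c := (ENNReal.ae_le_essSup (f a)).mono fun y hy => hy.trans h
        simpa [ae_iff, Function.uncurry] using h2
      · intro h
        refine essSup_le_of_ae_le c ?_
        have : ∀ᵐ y ∂μ, f a y ≤ c := by
          rw [ae_iff]
          simpa [Function.uncurry] using h
        exact this
    rw [h]
    exact measurable_measure_prodMk_left (measurableSet_lt measurable_const hf)
      (measurableSet_singleton 0)
  · simp only [eLpNorm_eq_lintegral_rpow_enorm_toReal h0 ht, enorm_eq_self]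
    exact ((hf.pow_const _).lintegral_prod_right').pow_const _

lemma measurable_cons {n : ℕ} {Ω : Fin (n + 1) → Type u} [∀ i, MeasurableSpace (Ω i)] :
    Measurable (fun z : (∀ i : Fin n, Ω i.succ) × Ω 0 => (Fin.cons z.2 z.1 : ∀ i, Ω i)) := by
  refine measurable_pi_iff.2 fun i => ?_
  refine Fin.cases ?_ (fun j => ?_) i
  · exact measurable_snd
  · exact (measurable_pi_apply (X := fun j : Fin n => Ω j.succ) j).comp measurable_fst

lemma measurable_inner {n : ℕ} {Ω : Fin (n + 1) → Type u} [∀ i, MeasurableSpace (Ω i)]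
    (μ : Measure (Ω 0)) [SigmaFinite μ] (p : ℝ≥0∞) {f : (∀ i, Ω i) → ℝ≥0∞} (hf : Measurable f) :
    Measurable (fun y : ∀ i : Fin n, Ω i.succ => eLpNorm (fun t => f (Fin.cons t y)) p μ) :=
  measurable_eLpNorm_param μ p (f := fun y t => f (Fin.cons t y)) (hf.comp measurable_cons)

lemma measurePreserving_cons {n : ℕ} {Ω : Fin (n + 1) → Type u} [∀ i, MeasurableSpace (Ω i)]
    (μ : ∀ i, Measure (Ω i)) [∀ i, SigmaFinite (μ i)] :
    MeasurePreserving (fun z : (∀ i : Fin n, Ω i.succ) × Ω 0 => (Fin.cons z.2 z.1 : ∀ i, Ω i))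
      ((Measure.pi fun i : Fin n => μ i.succ).prod (μ 0)) (Measure.pi μ) := by
  have h := (measurePreserving_piFinSuccAbove μ 0).symm.comp
    (Measure.measurePreserving_swap (μ := Measure.pi fun i : Fin n => μ i.succ) (ν := μ 0))
  convert h using 1
  funext z
  exact (Fin.insertNth_zero (α := Ω) z.2 z.1).symm

lemma ae_pi_succ_iff {n : ℕ} {Ω : Fin (n + 1) → Type u} [∀ i, MeasurableSpace (Ω i)]
    (μ : ∀ i, Measure (Ω i)) [∀ i, SigmaFinite (μ i)] {p : (∀ i, Ω i) → Prop}
    (hp : MeasurableSet {x | p x}) :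
    (∀ᵐ x ∂Measure.pi μ, p x) ↔
      ∀ᵐ y ∂(Measure.pi fun i : Fin n => μ i.succ), ∀ᵐ t ∂(μ 0), p (Fin.cons t y) := by
  rw [← (measurePreserving_cons μ).map_eq, ae_map_iff measurable_cons.aemeasurable hp]
  exact Measure.ae_prod_iff_ae_ae (measurable_cons hp)

lemma ae_ae_of_ae_pi {n : ℕ} {Ω : Fin (n + 1) → Type u} [∀ i, MeasurableSpace (Ω i)]
    (μ : ∀ i, Measure (Ω i)) [∀ i, SigmaFinite (μ i)] {p : (∀ i, Ω i) → Prop}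
    (h : ∀ᵐ x ∂Measure.pi μ, p x) :
    ∀ᵐ y ∂(Measure.pi fun i : Fin n => μ i.succ), ∀ᵐ t ∂(μ 0), p (Fin.cons t y) :=
  Measure.ae_ae_of_ae_prod ((measurePreserving_cons μ).quasiMeasurePreserving.ae h)

lemma mixedENorm_mono_ae {n : ℕ} {Ω : Fin n → Type u} [∀ i, MeasurableSpace (Ω i)]
    (μ : ∀ i, Measure (Ω i)) [∀ i, SigmaFinite (μ i)] (P : Fin n → ℝ≥0∞)
    {f g : (∀ i, Ω i) → ℝ≥0∞} (h : ∀ᵐ x ∂Measure.pi μ, f x ≤ g x) :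
    mixedENorm μ P f ≤ mixedENorm μ P g := by
  induction n with
  | zero =>
    rw [Measure.pi_of_empty, ae_dirac_eq] at h
    have : f (fun i => i.elim0) ≤ g (fun i => i.elim0) := by
      convert Filter.eventually_pure.1 h
    exact this
  | succ n ih =>
    refine ih _ _ ?_
    filter_upwards [ae_ae_of_ae_pi μ h] with y hy
    exact eLpNorm_mono_enorm_ae (by simpa using hy)

lemma mixedENorm_congr_ae {n : ℕ} {Ω : Fin n → Type u} [∀ i, MeasurableSpace (Ω i)]
    (μ : ∀ i, Measure (Ω i)) [∀ i, SigmaFinite (μ i)] (P : Fin n → ℝ≥0∞)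
    {f g : (∀ i, Ω i) → ℝ≥0∞} (h : f =ᵐ[Measure.pi μ] g) :
    mixedENorm μ P f = mixedENorm μ P g :=
  le_antisymm (mixedENorm_mono_ae μ P h.le) (mixedENorm_mono_ae μ P h.symm.le)

lemma mixedENorm_zero {n : ℕ} {Ω : Fin n → Type u} [∀ i, MeasurableSpace (Ω i)]
    (μ : ∀ i, Measure (Ω i)) (P : Fin n → ℝ≥0∞) : mixedENorm μ P 0 = 0 := by
  induction n with
  | zero => rfl
  | succ n ih =>
    refine Eq.trans ?_ (ih (fun i => μ i.succ) (fun i => P i.succ))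
    change mixedENorm _ _ (fun y => eLpNorm (0 : Ω 0 → ℝ≥0∞) (P 0) (μ 0)) = _
    simp only [eLpNorm_zero]
    rfl

lemma mixedENorm_add_le {n : ℕ} {Ω : Fin n → Type u} [∀ i, MeasurableSpace (Ω i)]
    (μ : ∀ i, Measure (Ω i)) [∀ i, SigmaFinite (μ i)] (P : Fin n → ℝ≥0∞) (hP : ∀ i, 1 ≤ P i)
    {f g : (∀ i, Ω i) → ℝ≥0∞} (hf : Measurable f) (hg : Measurable g) :
    mixedENorm μ P (f + g) ≤ mixedENorm μ P f + mixedENorm μ P g := by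
  induction n with
  | zero => exact le_rfl
  | succ n ih =>
    refine le_trans ?_ (ih (fun i => μ i.succ) (fun i => P i.succ) (fun i => hP i.succ)
      (measurable_inner (μ 0) (P 0) hf) (measurable_inner (μ 0) (P 0) hg))
    refine mixedENorm_mono_ae _ _ (ae_of_all _ fun y => ?_)
    have hc : Measurable (fun t : Ω 0 => (Fin.cons t y : ∀ i, Ω i)) :=
      measurable_cons.comp measurable_prodMk_left
    exact eLpNorm_add_le (hf.comp hc).aestronglyMeasurable (hg.comp hc).aestronglyMeasurable (hP 0)

lemma mixedENorm_const_mul_le {n : ℕ} {Ω : Fin n → Type u} [∀ i, MeasurableSpace (Ω i)]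
    (μ : ∀ i, Measure (Ω i)) [∀ i, SigmaFinite (μ i)] (P : Fin n → ℝ≥0∞) (c : NNReal)
    (f : (∀ i, Ω i) → ℝ≥0∞) :
    mixedENorm μ P (fun x => c * f x) ≤ c * mixedENorm μ P f := by
  induction n with
  | zero => exact le_rfl
  | succ n ih =>
    refine le_trans ?_ (ih (fun i => μ i.succ) (fun i => P i.succ) _)
    refine mixedENorm_mono_ae _ _ (ae_of_all _ fun y => ?_)
    exact eLpNorm_le_nnreal_smul_eLpNorm_of_ae_le_mul' (ae_of_all _ fun t => le_rfl) _

lemma ae_eq_zero_of_mixedENorm_eq_zero {n : ℕ} {Ω : Fin n → Type u} [∀ i, MeasurableSpace (Ω i)]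
    (μ : ∀ i, Measure (Ω i)) [∀ i, SigmaFinite (μ i)] (P : Fin n → ℝ≥0∞) (hP : ∀ i, 1 ≤ P i)
    {f : (∀ i, Ω i) → ℝ≥0∞} (hf : Measurable f) (h : mixedENorm μ P f = 0) :
    ∀ᵐ x ∂Measure.pi μ, f x = 0 := by
  induction n with
  | zero =>
    refine ae_of_all _ fun x => ?_
    rw [Subsingleton.elim x (fun i => i.elim0)]
    exact h
  | succ n ih =>
    refine (ae_pi_succ_iff μ (hf (measurableSet_singleton 0))).2 ?_
    filter_upwards [ih (fun i => μ i.succ) (fun i => P i.succ) (fun i => hP i.succ)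
      (measurable_inner (μ 0) (P 0) hf) h] with y hy
    have hc : Measurable (fun t : Ω 0 => (Fin.cons t y : ∀ i, Ω i)) :=
      measurable_cons.comp measurable_prodMk_left
    exact (eLpNorm_eq_zero_iff (hf.comp hc).aestronglyMeasurable
      (zero_lt_one.trans_le (hP 0)).ne').1 hy

end MixedENorm

/-- The weighted mixed norm `‖f‖_{L^P_w(μ)} = ‖f w‖_{L^P(μ)}` of a scalar function, with values
in `[0, ∞]`. -/
def weightedMixedENorm {𝕜 : Type v} [RCLike 𝕜] {n : ℕ} {Ω : Fin n → Type u}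
    [∀ i, MeasurableSpace (Ω i)] (μ : ∀ i, Measure (Ω i)) (P : Fin n → ℝ≥0∞)
    (w : Weight (∀ i, Ω i)) (f : (∀ i, Ω i) → 𝕜) : ℝ≥0∞ :=
  mixedENorm μ P (fun x => ‖f x‖ₑ * ENNReal.ofReal (w x))

section WeightedMixedENorm

variable {𝕜 : Type v} [RCLike 𝕜] {n : ℕ} {Ω : Fin n → Type u} [∀ i, MeasurableSpace (Ω i)]
  {μ : ∀ i, Measure (Ω i)} {P : Fin n → ℝ≥0∞} {w : Weight (∀ i, Ω i)}

lemma measurable_weighted (w : Weight (∀ i, Ω i)) (f : (∀ i, Ω i) →ₘ[Measure.pi μ] 𝕜) :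
    Measurable (fun x => ‖f x‖ₑ * ENNReal.ofReal (w x)) :=
  f.stronglyMeasurable.enorm.mul w.measurable'.ennreal_ofReal

lemma weightedMixedENorm_zero [∀ i, SigmaFinite (μ i)] :
    weightedMixedENorm μ P w ((0 : (∀ i, Ω i) →ₘ[Measure.pi μ] 𝕜)) = 0 := by
  rw [← mixedENorm_zero μ P]
  refine mixedENorm_congr_ae μ P ?_
  filter_upwards [AEEqFun.coeFn_zero (μ := Measure.pi μ) (α := ∀ i, Ω i) (β := 𝕜)] with x hx
  simp [hx]

lemma weightedMixedENorm_add_le [∀ i, SigmaFinite (μ i)] (hP : ∀ i, 1 ≤ P i)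
    (f g : (∀ i, Ω i) →ₘ[Measure.pi μ] 𝕜) :
    weightedMixedENorm μ P w (f + g : (∀ i, Ω i) →ₘ[Measure.pi μ] 𝕜)
      ≤ weightedMixedENorm μ P w f + weightedMixedENorm μ P w g := by
  refine le_trans (mixedENorm_mono_ae μ P ?_)
    (mixedENorm_add_le μ P hP (measurable_weighted w f) (measurable_weighted w g))
  filter_upwards [AEEqFun.coeFn_add f g] with x hx
  rw [hx, Pi.add_apply, Pi.add_apply, ← add_mul]
  gcongr
  exact enorm_add_le _ _

lemma weightedMixedENorm_smul_le [∀ i, SigmaFinite (μ i)] (c : 𝕜)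
    (f : (∀ i, Ω i) →ₘ[Measure.pi μ] 𝕜) :
    weightedMixedENorm μ P w (c • f : (∀ i, Ω i) →ₘ[Measure.pi μ] 𝕜)
      ≤ ‖c‖ₑ * weightedMixedENorm μ P w f := by
  refine le_trans (mixedENorm_mono_ae μ P ?_) (mixedENorm_const_mul_le μ P ‖c‖₊ _)
  filter_upwards [AEEqFun.coeFn_smul c f] with x hx
  rw [hx, Pi.smul_apply, enorm_smul, mul_assoc]
  rfl

lemma eq_zero_of_weightedMixedENorm_eq_zero [∀ i, SigmaFinite (μ i)] (hP : ∀ i, 1 ≤ P i)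
    (f : (∀ i, Ω i) →ₘ[Measure.pi μ] 𝕜) (h : weightedMixedENorm μ P w f = 0) : f = 0 := by
  refine AEEqFun.ext ?_
  filter_upwards [ae_eq_zero_of_mixedENorm_eq_zero μ P hP (measurable_weighted w f) h,
    AEEqFun.coeFn_zero (μ := Measure.pi μ) (α := ∀ i, Ω i) (β := 𝕜)] with x hx h0
  have hw : ENNReal.ofReal (w x) ≠ 0 := by simpa using w.pos' x
  rw [h0]
  simpa [hw] using hx

end WeightedMixedENorm

/-- The weighted mixed-norm space `L^P_w(μ)`, for exponents `1 ≤ pᵢ ≤ ∞`: the (classes modulo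
almost everywhere equality for the product measure of) measurable functions `f` with
`‖f w‖_{L^P(μ)} < ∞`. -/
def WeightedMixedLp (𝕜 : Type v) [RCLike 𝕜] {n : ℕ} {Ω : Fin n → Type u}
    [∀ i, MeasurableSpace (Ω i)] (μ : ∀ i, Measure (Ω i)) [∀ i, SigmaFinite (μ i)]
    (P : Fin n → ℝ≥0∞) [hP : ∀ i, Fact (1 ≤ P i)] (w : Weight (∀ i, Ω i)) :
    Submodule 𝕜 ((∀ i, Ω i) →ₘ[Measure.pi μ] 𝕜) where
  carrier := {f | weightedMixedENorm μ P w f < ∞}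
  zero_mem' := by
    change weightedMixedENorm μ P w _ < ∞
    rw [weightedMixedENorm_zero]
    exact ENNReal.zero_lt_top
  add_mem' := fun {f g} hf hg =>
    (weightedMixedENorm_add_le (fun i => (hP i).out) f g).trans_lt (ENNReal.add_lt_top.2 ⟨hf, hg⟩)
  smul_mem' := fun c f hf =>
    (weightedMixedENorm_smul_le c f).trans_lt (ENNReal.mul_lt_top enorm_lt_top hf)

section NormedSpace

variable {𝕜 : Type v} [RCLike 𝕜] {n : ℕ} {Ω : Fin n → Type u} [∀ i, MeasurableSpace (Ω i)]
  {μ : ∀ i, Measure (Ω i)} [∀ i, SigmaFinite (μ i)] {P : Fin n → ℝ≥0∞}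
  [hP : ∀ i, Fact (1 ≤ P i)] {w : Weight (∀ i, Ω i)}

/-- The norm `‖f‖_{L^P_w(μ)} = ‖f w‖_{L^P(μ)}` on `L^P_w(μ)`. -/
instance WeightedMixedLp.instNormedAddCommGroup : NormedAddCommGroup (WeightedMixedLp 𝕜 μ P w) :=
  AddGroupNorm.toNormedAddCommGroup
    { toFun := fun f => (weightedMixedENorm μ P w f.1).toReal
      map_zero' := by
        change (weightedMixedENorm μ P w (0 : (∀ i, Ω i) →ₘ[Measure.pi μ] 𝕜)).toReal = 0
        rw [weightedMixedENorm_zero, ENNReal.toReal_zero]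
      add_le' := fun f g => by
        have hf : weightedMixedENorm μ P w f.1 ≠ ∞ := ne_of_lt f.2
        have hg : weightedMixedENorm μ P w g.1 ≠ ∞ := ne_of_lt g.2
        rw [← ENNReal.toReal_add hf hg]
        exact ENNReal.toReal_mono (ENNReal.add_ne_top.2 ⟨hf, hg⟩)
          (weightedMixedENorm_add_le (fun i => (hP i).out) f.1 g.1)
      neg' := fun f => by
        congr 1
        refine mixedENorm_congr_ae μ P ?_
        filter_upwards [AEEqFun.coeFn_neg f.1] with x hx
        change ‖(-f.1 : (∀ i, Ω i) →ₘ[Measure.pi μ] 𝕜) x‖ₑ * _ = _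
        rw [hx, Pi.neg_apply, enorm_neg]
      eq_zero_of_map_eq_zero' := fun f hf => by
        refine Subtype.ext (eq_zero_of_weightedMixedENorm_eq_zero (w := w) (fun i => (hP i).out) f.1 ?_)
        exact ((ENNReal.toReal_eq_zero_iff _).1 hf).resolve_right (ne_of_lt f.2) }

lemma WeightedMixedLp.norm_def (f : WeightedMixedLp 𝕜 μ P w) :
    ‖f‖ = (weightedMixedENorm μ P w f.1).toReal := rfl

instance WeightedMixedLp.instNormedSpace : NormedSpace 𝕜 (WeightedMixedLp 𝕜 μ P w) where
  norm_smul_le := fun c f => by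
    have hf : weightedMixedENorm μ P w f.1 ≠ ∞ := ne_of_lt f.2
    have h := ENNReal.toReal_mono (ENNReal.mul_ne_top enorm_ne_top hf)
      (weightedMixedENorm_smul_le (μ := μ) (P := P) (w := w) c f.1)
    rwa [ENNReal.toReal_mul, toReal_enorm] at h

end NormedSpace

/-- A linear operator `T : E → F` between normed spaces is `r`-nuclear if there are sequences
`(x'ₙ)` in the dual of `E` and `(yₙ)` in `F` with `∑ₙ ‖x'ₙ‖^r ‖yₙ‖^r < ∞` and
`T x = ∑ₙ ⟨x, x'ₙ⟩ yₙ` (convergence in the norm of `F`) for all `x`. -/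
def IsRNuclear {𝕜 : Type*} [RCLike 𝕜] {E F : Type*} [NormedAddCommGroup E] [NormedSpace 𝕜 E]
    [NormedAddCommGroup F] [NormedSpace 𝕜 F] (r : ℝ) (T : E →ₗ[𝕜] F) : Prop :=
  ∃ (x' : ℕ → StrongDual 𝕜 E) (y : ℕ → F),
    Summable (fun n => ‖x' n‖ ^ r * ‖y n‖ ^ r) ∧ ∀ x, HasSum (fun n => x' n x • y n) (T x)

end

noncomputable section

open Filter Topology

/-! Both conditions express one expansion, `T f = ∑ ⟨f, hₙ⟩ gₙ`, where `⟨f, h⟩` is the integral of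
`h f`. On the nuclear side the series converges in norm; on the kernel side it is summed pointwise
under the integral sign.

Passing between functionals and functions is duality. By Hölder for mixed norms, every `h` in
`L^{P'}_{w⁻¹}` gives a functional of norm at most `‖h‖` (`toDual`). Conversely, since the exponents
are finite and `1` lies in `L^P_w`, the set function `A ↦ φ(1_A)` is countably additive by dominated
convergence, so Radon–Nikodym yields a density `h`. The converse of Hölder
(`mixedENorm_conjExponents_le`, by induction on the number of variables with measurably chosen
norming functions) bounds the norm of `h` by `‖φ‖`, and truncation extends the formula to all `f`
(`exists_dual_representation`).

Passing between the two kinds of convergence uses `r ≤ 1`, which turns the hypothesis into `∑ ‖gₙ‖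
‖hₙ‖ < ∞`. As `1` lies in `L^{Q'}_{w'⁻¹}`, the space `L^Q_{w'}` embeds in `L¹`, so Tonelli allows
exchanging sum and integral for a.e. `x` (`ae_kernel`). The same embedding identifies norm limits
with pointwise limits (`ae_eq_of_tendsto`), and the countable triangle inequality upgrades pointwise
sums to norm sums (`hasSum_of_ae_hasSum`). -/

/-! ### Hölder, Minkowski and limit theorems for mixed norms -/

lemma measurable_cons_left {n : ℕ} {Ω : Fin (n + 1) → Type u} [∀ i, MeasurableSpace (Ω i)]
    (y : ∀ i : Fin n, Ω i.succ) : Measurable (fun t : Ω 0 => (Fin.cons t y : ∀ i, Ω i)) :=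
  measurable_cons.comp measurable_prodMk_left

lemma lintegral_pi_succ {n : ℕ} {Ω : Fin (n + 1) → Type u} [∀ i, MeasurableSpace (Ω i)]
    (μ : ∀ i, Measure (Ω i)) [∀ i, SigmaFinite (μ i)] {f : (∀ i, Ω i) → ℝ≥0∞}
    (hf : Measurable f) :
    ∫⁻ x, f x ∂Measure.pi μ =
      ∫⁻ y, ∫⁻ t, f (Fin.cons t y) ∂μ 0 ∂Measure.pi fun i : Fin n => μ i.succ := by
  rw [← (measurePreserving_cons μ).lintegral_comp hf]
  exact lintegral_prod _ (hf.comp measurable_cons).aemeasurable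

/-- Hölder's inequality for a finite exponent and its conjugate. -/
lemma lintegral_mul_le_eLpNorm_mul {α : Type*} [MeasurableSpace α] (μ : Measure α) {p : ℝ≥0∞}
    (hp : 1 ≤ p) (hpt : p ≠ ∞) {f g : α → ℝ≥0∞} (hf : Measurable f) (hg : Measurable g) :
    ∫⁻ x, f x * g x ∂μ ≤ eLpNorm f p μ * eLpNorm g p.conjExponent μ := by
  rcases hp.eq_or_lt with rfl | h1
  · have : ENNReal.conjExponent 1 = ∞ := by simp [ENNReal.conjExponent]
    rw [this, eLpNorm_one_eq_lintegral_enorm, eLpNorm_exponent_top,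
      ← lintegral_mul_const _ (by simpa using hf)]
    refine lintegral_mono_ae ?_
    filter_upwards [ENNReal.ae_le_essSup (μ := μ) g] with x hx
    simp only [enorm_eq_self, eLpNormEssSup]
    gcongr
  · lift p to NNReal using hpt
    have h1' : 1 < p := by exact_mod_cast h1
    have hc := NNReal.HolderConjugate.conjExponent h1'
    have hc' : (p : ℝ≥0∞).conjExponent = (p.conjExponent : NNReal) :=
      (ENNReal.coe_conjExponent h1').symm
    rw [hc', eLpNorm_nnreal_eq_lintegral hc.ne_zero, eLpNorm_nnreal_eq_lintegral hc.symm.ne_zero]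
    exact ENNReal.lintegral_mul_le_Lp_mul_Lq μ hc.coe hf.aemeasurable hg.aemeasurable

/-- Hölder's inequality for mixed norms. -/
lemma lintegral_mul_le_mixedENorm_mul {n : ℕ} {Ω : Fin n → Type u} [∀ i, MeasurableSpace (Ω i)]
    (μ : ∀ i, Measure (Ω i)) [∀ i, SigmaFinite (μ i)] (P : Fin n → ℝ≥0∞) (hP : ∀ i, 1 ≤ P i)
    (hPt : ∀ i, P i ≠ ∞) {f g : (∀ i, Ω i) → ℝ≥0∞} (hf : Measurable f) (hg : Measurable g) :
    ∫⁻ x, f x * g x ∂Measure.pi μ ≤ mixedENorm μ P f * mixedENorm μ (conjExponents P) g := by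
  have hfg : Measurable fun x => f x * g x := hf.mul hg
  induction n with
  | zero =>
    rw [Measure.pi_of_empty _ (fun i => i.elim0), lintegral_dirac' _ hfg]
    exact le_rfl
  | succ n ih =>
    rw [lintegral_pi_succ μ hfg]
    refine le_trans (lintegral_mono fun y => ?_) (ih (fun i => μ i.succ) (fun i => P i.succ)
      (fun i => hP i.succ) (fun i => hPt i.succ) (measurable_inner (μ 0) (P 0) hf)
      (measurable_inner (μ 0) (conjExponents P 0) hg)
      ((measurable_inner (μ 0) (P 0) hf).mul (measurable_inner (μ 0) (conjExponents P 0) hg)))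
    exact lintegral_mul_le_eLpNorm_mul (μ 0) (hP 0) (hPt 0) (hf.comp (measurable_cons_left y))
      (hg.comp (measurable_cons_left y))

lemma lintegral_rpow_eq_eLpNorm_rpow {α : Type*} [MeasurableSpace α] (μ : Measure α) {p : ℝ≥0∞}
    (hp : p ≠ 0) (hpt : p ≠ ∞) (f : α → ℝ≥0∞) :
    ∫⁻ x, f x ^ p.toReal ∂μ = eLpNorm f p μ ^ p.toReal := by
  rw [eLpNorm_eq_lintegral_rpow_enorm_toReal hp hpt, ← ENNReal.rpow_mul, one_div,
    inv_mul_cancel₀ (ENNReal.toReal_pos hp hpt).ne', ENNReal.rpow_one]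
  simp

/-- Monotone convergence for `L^p`-norms. -/
lemma eLpNorm_iSup_le {α : Type*} [MeasurableSpace α] (μ : Measure α) {p : ℝ≥0∞}
    (hp : p ≠ 0) (hpt : p ≠ ∞) {f : ℕ → α → ℝ≥0∞} (hf : ∀ n, Measurable (f n))
    (hm : Monotone f) : eLpNorm (fun x => ⨆ n, f n x) p μ ≤ ⨆ n, eLpNorm (f n) p μ := by
  have hp0 := ENNReal.toReal_pos hp hpt
  rw [← ENNReal.rpow_le_rpow_iff hp0, ← lintegral_rpow_eq_eLpNorm_rpow μ hp hpt]
  have h : ∀ x, (⨆ n, f n x) ^ p.toReal = ⨆ n, f n x ^ p.toReal := fun x =>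
    (ENNReal.orderIsoRpow p.toReal hp0).map_iSup _
  simp only [h]
  rw [lintegral_iSup (fun n => (hf n).pow_const _)
    (fun i j hij x => ENNReal.rpow_le_rpow (hm hij x) hp0.le)]
  refine iSup_le fun n => ?_
  rw [lintegral_rpow_eq_eLpNorm_rpow μ hp hpt]
  exact ENNReal.rpow_le_rpow (le_iSup (fun n => eLpNorm (f n) p μ) n) hp0.le

/-- Countable Minkowski: the partial sums increase, so monotone convergence reduces it to finite
sums. -/
lemma eLpNorm_tsum_le {α : Type*} [MeasurableSpace α] (μ : Measure α) {p : ℝ≥0∞}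
    (hp : 1 ≤ p) (hpt : p ≠ ∞) {f : ℕ → α → ℝ≥0∞} (hf : ∀ n, Measurable (f n)) :
    eLpNorm (fun x => ∑' n, f n x) p μ ≤ ∑' n, eLpNorm (f n) p μ := by
  have h : (fun x => ∑' n, f n x) = fun x => ⨆ N, (∑ n ∈ Finset.range N, f n) x := by
    funext x
    simp only [ENNReal.tsum_eq_iSup_nat, Finset.sum_apply]
  rw [h]
  refine (eLpNorm_iSup_le μ (zero_lt_one.trans_le hp).ne' hpt
    (f := fun N => ∑ n ∈ Finset.range N, f n) (fun N => ?_) ?_).trans (iSup_le fun N => ?_)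
  · rw [Finset.sum_fn]
    exact Finset.measurable_sum _ fun n _ => hf n
  · intro i j hij
    exact Finset.sum_le_sum_of_subset (Finset.range_mono hij)
  · have h1 : eLpNorm (∑ n ∈ Finset.range N, f n) p μ ≤ ∑ n ∈ Finset.range N, eLpNorm (f n) p μ :=
      eLpNorm_sum_le (fun n _ => (hf n).aestronglyMeasurable) hp
    exact h1.trans (ENNReal.sum_le_tsum (Finset.range N))

lemma mixedENorm_tsum_le {n : ℕ} {Ω : Fin n → Type u} [∀ i, MeasurableSpace (Ω i)]
    (μ : ∀ i, Measure (Ω i)) [∀ i, SigmaFinite (μ i)] (P : Fin n → ℝ≥0∞) (hP : ∀ i, 1 ≤ P i)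
    (hPt : ∀ i, P i ≠ ∞) {f : ℕ → (∀ i, Ω i) → ℝ≥0∞} (hf : ∀ k, Measurable (f k)) :
    mixedENorm μ P (fun x => ∑' k, f k x) ≤ ∑' k, mixedENorm μ P (f k) := by
  induction n with
  | zero => exact le_rfl
  | succ n ih =>
    refine le_trans ?_ (ih (fun i => μ i.succ) (fun i => P i.succ) (fun i => hP i.succ)
      (fun i => hPt i.succ) (fun k => measurable_inner (μ 0) (P 0) (hf k)))
    exact mixedENorm_mono_ae _ _ (ae_of_all _ fun y => eLpNorm_tsum_le (μ 0) (hP 0) (hPt 0)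
      fun k => (hf k).comp (measurable_cons_left y))

/-- Finiteness descends from the outer norm to the fibre norms for a.e. `y`, and then to the values,
because the `p`-th power has finite integral on such a fibre. -/
lemma ae_lt_top_of_mixedENorm_lt_top {n : ℕ} {Ω : Fin n → Type u} [∀ i, MeasurableSpace (Ω i)]
    (μ : ∀ i, Measure (Ω i)) [∀ i, SigmaFinite (μ i)] (P : Fin n → ℝ≥0∞) (hP : ∀ i, 1 ≤ P i)
    (hPt : ∀ i, P i ≠ ∞) {f : (∀ i, Ω i) → ℝ≥0∞} (hf : Measurable f)
    (h : mixedENorm μ P f < ∞) : ∀ᵐ x ∂Measure.pi μ, f x < ∞ := by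
  induction n with
  | zero =>
    refine ae_of_all _ fun x => ?_
    rw [Subsingleton.elim x (fun i => i.elim0)]
    exact h
  | succ n ih =>
    refine (ae_pi_succ_iff μ (hf measurableSet_Iio)).2 ?_
    filter_upwards [ih (fun i => μ i.succ) (fun i => P i.succ) (fun i => hP i.succ)
      (fun i => hPt i.succ) (measurable_inner (μ 0) (P 0) hf) h] with y hy
    have h0 : P 0 ≠ 0 := (zero_lt_one.trans_le (hP 0)).ne'
    have hp0 := ENNReal.toReal_pos h0 (hPt 0)
    filter_upwards [ae_lt_top ((hf.comp (measurable_cons_left y)).pow_const (P 0).toReal)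
      ((lintegral_rpow_eq_eLpNorm_rpow (μ 0) h0 (hPt 0) _).trans_ne
        (ENNReal.rpow_lt_top_of_nonneg hp0.le hy.ne).ne)] with t ht
    exact (ENNReal.rpow_lt_top_iff_of_pos hp0).1 ht

lemma tendsto_eLpNorm_zero_of_dominated {α ι : Type*} [MeasurableSpace α] (μ : Measure α)
    {l : Filter ι} [l.IsCountablyGenerated] {p : ℝ≥0∞}
    (hp : p ≠ 0) (hpt : p ≠ ∞) {F : ι → α → ℝ≥0∞} (hF : ∀ i, Measurable (F i)) (G : α → ℝ≥0∞)
    (hFG : ∀ i x, F i x ≤ G x) (hG : eLpNorm G p μ ≠ ∞)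
    (hlim : ∀ᵐ x ∂μ, Tendsto (fun i => F i x) l (𝓝 0)) :
    Tendsto (fun i => eLpNorm (F i) p μ) l (𝓝 0) := by
  have hp0 := ENNReal.toReal_pos hp hpt
  have key : Tendsto (fun i => ∫⁻ x, F i x ^ p.toReal ∂μ) l (𝓝 (∫⁻ _, 0 ∂μ)) := by
    refine tendsto_lintegral_filter_of_dominated_convergence (fun x => G x ^ p.toReal)
      (Eventually.of_forall fun i => (hF i).pow_const _)
      (Eventually.of_forall fun i => ae_of_all _ fun x => ENNReal.rpow_le_rpow (hFG i x) hp0.le)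
      ((lintegral_rpow_eq_eLpNorm_rpow μ hp hpt _).trans_ne
        (ENNReal.rpow_lt_top_of_nonneg hp0.le hG).ne) ?_
    filter_upwards [hlim] with x hx
    simpa [ENNReal.zero_rpow_of_pos hp0] using hx.ennrpow_const p.toReal
  simp only [lintegral_rpow_eq_eLpNorm_rpow μ hp hpt, lintegral_zero] at key
  have := key.ennrpow_const p.toReal⁻¹
  simpa only [← ENNReal.rpow_mul, mul_inv_cancel₀ hp0.ne', ENNReal.rpow_one,
    ENNReal.zero_rpow_of_pos (inv_pos.2 hp0)] using this

/-- Dominated convergence to zero for mixed norms with finite exponents. -/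
lemma tendsto_mixedENorm_zero_of_dominated {n : ℕ} {Ω : Fin n → Type u}
    [∀ i, MeasurableSpace (Ω i)] (μ : ∀ i, Measure (Ω i)) [∀ i, SigmaFinite (μ i)]
    (P : Fin n → ℝ≥0∞) (hP : ∀ i, 1 ≤ P i) (hPt : ∀ i, P i ≠ ∞) {ι : Type*} {l : Filter ι}
    [l.IsCountablyGenerated] {F : ι → (∀ i, Ω i) → ℝ≥0∞} (hF : ∀ k, Measurable (F k))
    {G : (∀ i, Ω i) → ℝ≥0∞} (hGm : Measurable G) (hFG : ∀ k x, F k x ≤ G x)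
    (hG : mixedENorm μ P G < ∞) (hlim : ∀ᵐ x ∂Measure.pi μ, Tendsto (fun k => F k x) l (𝓝 0)) :
    Tendsto (fun k => mixedENorm μ P (F k)) l (𝓝 0) := by
  induction n with
  | zero =>
    rw [Measure.pi_of_empty, ae_dirac_eq] at hlim
    have h : ∀ k, mixedENorm μ P (F k) = F k isEmptyElim := fun k =>
      congrArg (F k) (Subsingleton.elim _ _)
    simpa only [h] using Filter.eventually_pure.1 hlim
  | succ n ih =>
    -- Dominated convergence on a fibre needs a dominating function of finite norm there; this holds
    -- on almost every fibre.
    have hfin := ae_lt_top_of_mixedENorm_lt_top (fun i => μ i.succ) (fun i => P i.succ)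
      (fun i => hP i.succ) (fun i => hPt i.succ) (measurable_inner (μ 0) (P 0) hGm) hG
    refine ih (fun i => μ i.succ) (fun i => P i.succ) (fun i => hP i.succ) (fun i => hPt i.succ)
      (fun k => measurable_inner (μ 0) (P 0) (hF k)) (measurable_inner (μ 0) (P 0) hGm)
      (fun k y => eLpNorm_mono_enorm (by simpa using fun t => hFG k _)) hG ?_
    filter_upwards [hfin, ae_ae_of_ae_pi μ hlim] with y hy hy'
    exact tendsto_eLpNorm_zero_of_dominated (μ 0) (zero_lt_one.trans_le (hP 0)).ne' (hPt 0)
      (fun k => (hF k).comp (measurable_cons_left y)) _ (fun k t => hFG k _) hy.ne hy'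

/-! ### Converse of Hölder's inequality for mixed norms -/

/-- For `p = 1`: normalised indicators of superlevel sets recover the essential supremum. -/
lemma exists_norming_seq_one {A B : Type*} [MeasurableSpace A] [MeasurableSpace B] (μ : Measure B)
    [SigmaFinite μ] {h : A → B → ℝ≥0∞} (hh : Measurable (Function.uncurry h)) :
    ∃ f : ℕ → A → B → ℝ≥0∞, (∀ k, Measurable (Function.uncurry (f k))) ∧
      (∀ k a, eLpNorm (f k a) 1 μ ≤ 1) ∧
      ∀ a, eLpNorm (h a) ∞ μ ≤ ⨆ k, ∫⁻ t, h a t * f k a t ∂μ := by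
  obtain ⟨e, he⟩ := exists_surjective_nat (ℕ × ℕ)
  set d : ℕ → ℝ≥0∞ := TopologicalSpace.denseSeq ℝ≥0∞
  have hd : Dense (Set.range d) := TopologicalSpace.denseRange_denseSeq ℝ≥0∞
  set S := spanningSets μ
  -- The index `k` encodes a threshold from a countable dense set and a spanning set; the latter
  -- keeps the slices of finite measure.
  let s : ℕ → Set (A × B) := fun k =>
    {z | d (e k).1 < h z.1 z.2} ∩ Prod.snd ⁻¹' S (e k).2
  have hs : ∀ k, MeasurableSet (s k) := fun k =>
    (measurableSet_lt measurable_const hh).inter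
      (measurable_snd (measurableSet_spanningSets μ _))
  have hsa : ∀ k a, MeasurableSet (Prod.mk a ⁻¹' s k) := fun k a => measurable_prodMk_left (hs k)
  -- On a null slice the value is `∞`, but the integral is then `∞ * 0 = 0`, so the bound by `1`
  -- persists.
  let f : ℕ → A → B → ℝ≥0∞ := fun k a =>
    (Prod.mk a ⁻¹' s k).indicator fun _ => (μ (Prod.mk a ⁻¹' s k))⁻¹
  refine ⟨f, fun k => ?_, fun k a => ?_, fun a => ?_⟩
  · have : Function.uncurry (f k) = (s k).indicator fun z => (μ (Prod.mk z.1 ⁻¹' s k))⁻¹ := by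
      funext z
      rfl
    rw [this]
    exact (((measurable_measure_prodMk_left (hs k)).comp measurable_fst).inv).indicator (hs k)
  · rw [eLpNorm_one_eq_lintegral_enorm]
    simp only [enorm_eq_self, f]
    rw [lintegral_indicator (hsa k a), setLIntegral_const]
    exact ENNReal.inv_mul_le_one _
  · refine le_of_forall_lt fun c hc => ?_
    obtain ⟨_, ⟨i, rfl⟩, hi, hi'⟩ := hd.exists_between hc
    have hpos : μ {t | d i < h a t} ≠ 0 := by
      intro h0
      refine hi'.not_ge ?_
      rw [eLpNorm_exponent_top]
      refine essSup_le_of_ae_le _ ?_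
      rw [EventuallyLE, ae_iff]
      simpa using h0
    -- The spanning sets cover the space, so one of them meets the superlevel set in positive
    -- measure.
    obtain ⟨j, hj⟩ : ∃ j, μ ({t | d i < h a t} ∩ S j) ≠ 0 := by
      by_contra! hcon
      refine hpos ?_
      rw [← Set.inter_univ {t | d i < h a t}, ← iUnion_spanningSets μ, Set.inter_iUnion]
      exact measure_iUnion_null hcon
    obtain ⟨k, hk⟩ := he (i, j)
    have hsk : Prod.mk a ⁻¹' s k = {t | d i < h a t} ∩ S j := by
      simp only [s, hk]
      rfl
    refine hi.trans_le (le_trans ?_ (le_iSup _ k))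
    have hfin : μ (Prod.mk a ⁻¹' s k) ≠ ∞ :=
      ((measure_mono (hsk ▸ Set.inter_subset_right)).trans_lt (measure_spanningSets_lt_top μ j)).ne
    calc d i = ∫⁻ t, d i * f k a t ∂μ := by
          simp only [f]
          rw [lintegral_const_mul _ (measurable_const.indicator (hsa k a)),
            lintegral_indicator (hsa k a), setLIntegral_const,
            ENNReal.inv_mul_cancel (hsk ▸ hj) hfin, mul_one]
      _ ≤ _ := by
          refine lintegral_mono fun t => ?_
          by_cases ht : t ∈ Prod.mk a ⁻¹' s k
          · gcongr
            rw [hsk] at ht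
            exact ht.1.le
          · simp [f, ht]

/-- For `1 < p < ∞`: normalised powers of truncations recover the dual norm. -/
lemma exists_norming_seq_of_one_lt {A B : Type*} [MeasurableSpace A] [MeasurableSpace B]
    (μ : Measure B) [SigmaFinite μ] {p q : NNReal} (hpq : p.HolderConjugate q)
    {h : A → B → ℝ≥0∞} (hh : Measurable (Function.uncurry h)) :
    ∃ f : ℕ → A → B → ℝ≥0∞, (∀ k, Measurable (Function.uncurry (f k))) ∧
      (∀ k a, eLpNorm (f k a) p μ ≤ 1) ∧
      ∀ a, eLpNorm (h a) q μ ≤ ⨆ k, ∫⁻ t, h a t * f k a t ∂μ := by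
  have hpq' := hpq.coe
  have hp0 : (0 : ℝ) < p := hpq'.pos
  have hq0 : (0 : ℝ) < q := hpq'.symm.pos
  have hq1 : (0 : ℝ) < q - 1 := hpq'.symm.sub_one_pos
  have hmul : ((q : ℝ) - 1) * p = q := hpq'.symm.sub_one_mul_conj
  have hpE : (p : ℝ≥0∞) ≠ 0 := by exact_mod_cast hpq.ne_zero
  have hqE : (q : ℝ≥0∞) ≠ 0 := by exact_mod_cast hpq.symm.ne_zero
  set S := spanningSets μ
  -- Truncation in height and in support: `g k a` has finite `q`-norm and increases to `h a`.
  let g : ℕ → A → B → ℝ≥0∞ := fun k a => (S k).indicator fun t => min (h a t) k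
  have hg : ∀ k, Measurable (Function.uncurry (g k)) := fun k => by
    have : Function.uncurry (g k) = (Prod.snd ⁻¹' S k).indicator
        fun z => min (Function.uncurry h z) k := by
      funext z
      rfl
    rw [this]
    exact (hh.min measurable_const).indicator (measurable_snd (measurableSet_spanningSets μ _))
  have hga : ∀ k a, Measurable (g k a) := fun k a => (hg k).comp measurable_prodMk_left
  have hgh : ∀ k a t, g k a t ≤ h a t := fun k a t =>
    Set.indicator_apply_le' (fun _ => min_le_left _ _) fun _ => zero_le
  have hgm : ∀ a, Monotone fun k => g k a := fun a i j hij t => by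
    have h1 : min (h a t) (i : ℝ≥0∞) ≤ min (h a t) j := min_le_min le_rfl (by exact_mod_cast hij)
    by_cases ht : t ∈ S i
    · have ht' : t ∈ S j := monotone_spanningSets μ hij ht
      simpa only [g, Set.indicator_of_mem ht, Set.indicator_of_mem ht'] using h1
    · simp only [g, Set.indicator_of_notMem ht, zero_le]
  have hgsup : ∀ a t, ⨆ k, g k a t = h a t := fun a t => by
    refine le_antisymm (iSup_le fun k => hgh k a t) (le_of_forall_lt fun c hc => ?_)
    obtain ⟨i, hi⟩ := ENNReal.exists_nat_gt (hc.trans_le le_top).ne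
    have ht : t ∈ S (max i (spanningSetsIndex μ t)) :=
      monotone_spanningSets μ (le_max_right _ _) (mem_spanningSetsIndex μ t)
    -- At this index `t` is in the support and the height cap exceeds `c`.
    refine lt_of_lt_of_le ?_ (le_iSup _ (max i (spanningSetsIndex μ t)))
    simp only [g, Set.indicator_of_mem ht]
    exact lt_min hc (hi.trans_le (by exact_mod_cast le_max_left _ _))
  let N : ℕ → A → ℝ≥0∞ := fun k a => eLpNorm (g k a) q μ
  have hNm : ∀ k, Measurable (N k) := fun k => measurable_eLpNorm_param μ q (hg k)
  have hN : ∀ k a, ∫⁻ t, g k a t ^ (q : ℝ) ∂μ = N k a ^ (q : ℝ) := fun k a =>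
    lintegral_rpow_eq_eLpNorm_rpow μ hqE ENNReal.coe_ne_top _
  have hNfin : ∀ k a, N k a ≠ ∞ := fun k a => by
    have : ∫⁻ t, g k a t ^ (q : ℝ) ∂μ < ∞ := by
      calc ∫⁻ t, g k a t ^ (q : ℝ) ∂μ
          ≤ ∫⁻ t, (S k).indicator (fun _ => (k : ℝ≥0∞) ^ (q : ℝ)) t ∂μ := by
            refine lintegral_mono fun t => ?_
            by_cases ht : t ∈ S k
            · simp only [g, Set.indicator_of_mem ht]
              exact ENNReal.rpow_le_rpow (min_le_right _ _) hq0.le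
            · simp [g, ht, hq0]
        _ < ∞ := by
            rw [lintegral_indicator (measurableSet_spanningSets μ k), setLIntegral_const]
            exact ENNReal.mul_lt_top (ENNReal.rpow_lt_top_of_nonneg hq0.le (by simp))
              (measure_spanningSets_lt_top μ k)
    rw [hN] at this
    exact ((ENNReal.rpow_lt_top_iff_of_pos hq0).1 this).ne
  -- The equality case of Hölder: since `(q - 1) p = q`, the `p`-th power integrates to `N^q / N^q ≤
  -- 1`, while the pairing with `g` is `N^q / N^(q-1) = N`. When `N = 0` the convention `0 * ∞ = 0`
  -- keeps the first bound.
  refine ⟨fun k a t => g k a t ^ ((q : ℝ) - 1) * (N k a ^ ((q : ℝ) - 1))⁻¹, fun k => ?_,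
    fun k a => ?_, fun a => ?_⟩
  · exact ((hg k).pow_const _).mul ((((hNm k).comp measurable_fst).pow_const _).inv)
  · rw [← ENNReal.rpow_le_rpow_iff hp0, ENNReal.one_rpow]
    refine (lintegral_rpow_eq_eLpNorm_rpow μ hpE ENNReal.coe_ne_top _).symm.trans_le ?_
    simp only [ENNReal.coe_toReal, ENNReal.mul_rpow_of_nonneg _ _ hp0.le, ← ENNReal.rpow_mul, hmul,
      ENNReal.inv_rpow]
    rw [lintegral_mul_const _ ((hga k a).pow_const _), hN]
    exact ENNReal.mul_inv_le_one _
  · calc eLpNorm (h a) q μ = eLpNorm (fun t => ⨆ k, g k a t) q μ := by simp only [hgsup]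
      _ ≤ ⨆ k, N k a := eLpNorm_iSup_le μ hqE ENNReal.coe_ne_top (fun k => hga k a) (hgm a)
      _ ≤ _ := iSup_mono fun k => ?_
    rcases eq_or_ne (N k a) 0 with h0 | h0
    · simp [h0]
    calc N k a = N k a ^ (q : ℝ) * (N k a ^ ((q : ℝ) - 1))⁻¹ := by
          rw [← ENNReal.rpow_neg, ← ENNReal.rpow_add _ _ h0 (hNfin k a)]
          simp
      _ = ∫⁻ t, g k a t ^ (q : ℝ) * (N k a ^ ((q : ℝ) - 1))⁻¹ ∂μ := by
          rw [lintegral_mul_const _ ((hga k a).pow_const _), hN]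
      _ ≤ _ := by
          refine lintegral_mono fun t => ?_
          rw [← mul_assoc]
          gcongr
          calc g k a t ^ (q : ℝ) = g k a t * g k a t ^ ((q : ℝ) - 1) := by
                conv_rhs => rw [← ENNReal.rpow_one (g k a t), ← ENNReal.rpow_mul, one_mul]
                rw [← ENNReal.rpow_add_of_nonneg _ _ zero_le_one hq1.le]
                simp
            _ ≤ _ := by
                gcongr
                exact hgh k a t

lemma exists_norming_seq {A B : Type*} [MeasurableSpace A] [MeasurableSpace B]
    (μ : Measure B) [SigmaFinite μ] {p : ℝ≥0∞} (hp : 1 ≤ p) (hpt : p ≠ ∞)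
    {h : A → B → ℝ≥0∞} (hh : Measurable (Function.uncurry h)) :
    ∃ f : ℕ → A → B → ℝ≥0∞, (∀ k, Measurable (Function.uncurry (f k))) ∧
      (∀ k a, eLpNorm (f k a) p μ ≤ 1) ∧
      ∀ a, eLpNorm (h a) p.conjExponent μ ≤ ⨆ k, ∫⁻ t, h a t * f k a t ∂μ := by
  rcases hp.eq_or_lt with rfl | h1
  · have : ENNReal.conjExponent 1 = ∞ := by simp [ENNReal.conjExponent]
    rw [this]
    exact exists_norming_seq_one μ hh
  · lift p to NNReal using hpt
    have h1' : 1 < p := by exact_mod_cast h1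
    have hc' : (p : ℝ≥0∞).conjExponent = (p.conjExponent : NNReal) :=
      (ENNReal.coe_conjExponent h1').symm
    rw [hc']
    exact exists_norming_seq_of_one_lt μ (.conjExponent h1') hh

/-- The norming functions can be chosen with nondecreasing pairings. -/
lemma exists_monotone_norming_seq {A B : Type*} [MeasurableSpace A] [MeasurableSpace B]
    (μ : Measure B) [SigmaFinite μ] {p : ℝ≥0∞} (hp : 1 ≤ p) (hpt : p ≠ ∞)
    {h : A → B → ℝ≥0∞} (hh : Measurable (Function.uncurry h)) :
    ∃ f : ℕ → A → B → ℝ≥0∞, (∀ k, Measurable (Function.uncurry (f k))) ∧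
      (∀ k a, eLpNorm (f k a) p μ ≤ 1) ∧
      (∀ a, Monotone fun k => ∫⁻ t, h a t * f k a t ∂μ) ∧
      ∀ a, eLpNorm (h a) p.conjExponent μ ≤ ⨆ k, ∫⁻ t, h a t * f k a t ∂μ := by
  classical
  obtain ⟨f, hfm, hf1, hf⟩ := exists_norming_seq μ hp hpt hh
  let I : (A → B → ℝ≥0∞) → A → ℝ≥0∞ := fun φ a => ∫⁻ t, h a t * φ a t ∂μ
  have hI : ∀ φ : A → B → ℝ≥0∞, Measurable (Function.uncurry φ) → Measurable (I φ) :=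
    fun φ hφ => (hh.mul hφ).lintegral_prod_right'
  -- A running maximum: for each `a`, keep the current function or take the next one, whichever
  -- pairs better with `h a`. The choice depends on `a` alone, so each slice of `F k` is a slice of
  -- some `f j` and the norm bound survives.
  let F : ℕ → A → B → ℝ≥0∞ := fun k => Nat.rec (f 0)
    (fun k φ a => if I φ a ≤ I (f (k + 1)) a then f (k + 1) a else φ a) k
  have hF : ∀ k a, F (k + 1) a = if I (F k) a ≤ I (f (k + 1)) a then f (k + 1) a else F k a :=
    fun k a => rfl
  have hFm : ∀ k, Measurable (Function.uncurry (F k)) := by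
    intro k
    induction k with
    | zero => exact hfm 0
    | succ k ih =>
      have : Function.uncurry (F (k + 1)) = fun z : A × B =>
          if I (F k) z.1 ≤ I (f (k + 1)) z.1 then Function.uncurry (f (k + 1)) z
          else Function.uncurry (F k) z := by
        funext z
        simp only [Function.uncurry, hF]
        split_ifs <;> rfl
      rw [this]
      exact Measurable.ite (measurableSet_le ((hI _ ih).comp measurable_fst)
        ((hI _ (hfm _)).comp measurable_fst)) (hfm _) ih
  have hstep : ∀ k a, I (F k) a ≤ I (F (k + 1)) a ∧ I (f (k + 1)) a ≤ I (F (k + 1)) a := by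
    intro k a
    have : I (F (k + 1)) a = if I (F k) a ≤ I (f (k + 1)) a then I (f (k + 1)) a else I (F k) a := by
      simp only [I, hF]
      split_ifs <;> rfl
    rw [this]
    split_ifs with hc
    · exact ⟨hc, le_rfl⟩
    · exact ⟨le_rfl, (not_le.1 hc).le⟩
  refine ⟨F, hFm, fun k a => ?_, fun a => monotone_nat_of_le_succ fun k => (hstep k a).1,
    fun a => (hf a).trans (iSup_mono fun k => ?_)⟩
  · induction k with
    | zero => exact hf1 0 a
    | succ k ih =>
      rw [hF]
      split_ifs
      · exact hf1 _ a
      · exact ih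
  · cases k with
    | zero => exact le_rfl
    | succ k => exact (hstep k a).2

lemma measurable_tail {n : ℕ} {Ω : Fin (n + 1) → Type u} [∀ i, MeasurableSpace (Ω i)] :
    Measurable (fun x : ∀ i, Ω i => (fun i : Fin n => x i.succ)) :=
  measurable_pi_lambda _ fun i => measurable_pi_apply i.succ

/-- The converse of Hölder's inequality for mixed norms with finite exponents. -/
lemma mixedENorm_conjExponents_le {n : ℕ} {Ω : Fin n → Type u} [∀ i, MeasurableSpace (Ω i)]
    (μ : ∀ i, Measure (Ω i)) [∀ i, SigmaFinite (μ i)] (P : Fin n → ℝ≥0∞) (hP : ∀ i, 1 ≤ P i)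
    (hPt : ∀ i, P i ≠ ∞) {h : (∀ i, Ω i) → ℝ≥0∞} (hh : Measurable h) (c : ℝ≥0∞)
    (hc : ∀ f : (∀ i, Ω i) → ℝ≥0∞, Measurable f →
      ∫⁻ x, h x * f x ∂Measure.pi μ ≤ c * mixedENorm μ P f) :
    mixedENorm μ (conjExponents P) h ≤ c := by
  induction n with
  | zero =>
    have := hc (fun _ => 1) measurable_const
    rw [Measure.pi_of_empty _ (fun i => i.elim0)] at this
    simp only [mul_one] at this
    rw [lintegral_dirac' _ hh] at this
    exact this.trans_eq (mul_one c)
  | succ n ih =>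
    have hh' : Measurable (Function.uncurry fun (y : ∀ i : Fin n, Ω i.succ) t =>
      h (Fin.cons t y)) := hh.comp measurable_cons
    obtain ⟨f, hfm, hf1, hmono, hf⟩ := exists_monotone_norming_seq (μ 0) (hP 0) (hPt 0) hh'
    refine ih (fun i => μ i.succ) (fun i => P i.succ) (fun i => hP i.succ)
      (fun i => hPt i.succ) (measurable_inner (μ 0) _ hh) fun φ hφ => ?_
    have hI : ∀ k, Measurable fun y => ∫⁻ t, h (Fin.cons t y) * f k y t ∂μ 0 := fun k =>
      (hh'.mul (hfm k)).lintegral_prod_right'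
    -- Monotone pairings let the supremum over `k` leave the outer integral by monotone convergence.
    calc ∫⁻ y, eLpNorm (fun t => h (Fin.cons t y)) (conjExponents P 0) (μ 0) * φ y
          ∂(Measure.pi fun i : Fin n => μ i.succ)
        ≤ ∫⁻ y, ⨆ k, (∫⁻ t, h (Fin.cons t y) * f k y t ∂μ 0) * φ y
          ∂(Measure.pi fun i : Fin n => μ i.succ) := by
          refine lintegral_mono fun y => ?_
          rw [← ENNReal.iSup_mul]
          gcongr
          exact hf y
      _ = ⨆ k, ∫⁻ y, (∫⁻ t, h (Fin.cons t y) * f k y t ∂μ 0) * φ y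
          ∂(Measure.pi fun i : Fin n => μ i.succ) :=
          lintegral_iSup (fun k => (hI k).mul hφ)
            fun i j hij y => mul_le_mul_left (hmono y hij) _
      _ ≤ _ := iSup_le fun k => ?_
    -- The test function for the full space: the norming function in the first variable times the
    -- given `φ` in the others.
    have hfk : Measurable fun x : ∀ i, Ω i =>
        f k (fun i : Fin n => x i.succ) (x 0) * φ (fun i : Fin n => x i.succ) :=
      ((hfm k).comp (measurable_tail.prodMk (measurable_pi_apply 0))).mul
        (hφ.comp measurable_tail)
    refine le_trans (le_of_eq ?_) ((hc _ hfk).trans (mul_le_mul_right ?_ c))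
    · refine Eq.trans (lintegral_congr fun y => ?_) (lintegral_pi_succ μ (hh.mul hfk)).symm
      have hy : Measurable fun t => h (Fin.cons t y) * f k y t :=
        (hh'.mul (hfm k)).comp measurable_prodMk_left
      rw [← lintegral_mul_const _ hy]
      refine lintegral_congr fun t => ?_
      simp only [Pi.mul_apply, Fin.cons_succ, Fin.cons_zero, mul_assoc]
    -- The fibre norm of `f k y` is at most `1`, so the inner norm is at most `φ y`. As `φ y` may be
    -- `∞`, the factor is extracted from the integral of `p`-th powers.
    · refine mixedENorm_mono_ae _ _ (ae_of_all _ fun y => ?_)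
      simp only [Fin.cons_succ, Fin.cons_zero]
      have h0 : P 0 ≠ 0 := (zero_lt_one.trans_le (hP 0)).ne'
      have hp0 := ENNReal.toReal_pos h0 (hPt 0)
      have hfy : Measurable (f k y) := (hfm k).comp measurable_prodMk_left
      rw [← ENNReal.rpow_le_rpow_iff hp0, ← lintegral_rpow_eq_eLpNorm_rpow (μ 0) h0 (hPt 0)]
      simp only [ENNReal.mul_rpow_of_nonneg _ _ hp0.le]
      rw [lintegral_mul_const _ (hfy.pow_const _), lintegral_rpow_eq_eLpNorm_rpow (μ 0) h0 (hPt 0)]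
      exact mul_le_of_le_one_left' (ENNReal.rpow_le_one (hf1 k y) hp0.le)

/-! ### Weighted norms and dominated convergence in the weighted space -/

section WeightedNorm

variable {𝕜 : Type v} [RCLike 𝕜] {n : ℕ} {Ω : Fin n → Type u} [∀ i, MeasurableSpace (Ω i)]
  {μ : ∀ i, Measure (Ω i)} [∀ i, SigmaFinite (μ i)] {P : Fin n → ℝ≥0∞} {w : Weight (∀ i, Ω i)}

lemma Weight.measurable_ofReal {X : Type*} [MeasurableSpace X] (w : Weight X) :
    Measurable fun x => ENNReal.ofReal (w x) :=
  w.measurable'.ennreal_ofReal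

lemma Weight.ofReal_mul_ofReal_inv {X : Type*} [MeasurableSpace X] (w : Weight X) (x : X) :
    ENNReal.ofReal (w x) * ENNReal.ofReal (w⁻¹ x) = 1 := by
  rw [← ENNReal.ofReal_mul (w.pos' x).le]
  change ENNReal.ofReal (w x * (w x)⁻¹) = 1
  rw [mul_inv_cancel₀ (w.pos' x).ne', ENNReal.ofReal_one]

lemma weightedMixedENorm_mono_ae {f g : (∀ i, Ω i) → 𝕜}
    (h : ∀ᵐ x ∂Measure.pi μ, ‖f x‖ₑ ≤ ‖g x‖ₑ) :
    weightedMixedENorm μ P w f ≤ weightedMixedENorm μ P w g := by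
  refine mixedENorm_mono_ae μ P ?_
  filter_upwards [h] with x hx
  gcongr

lemma weightedMixedENorm_congr_ae {f g : (∀ i, Ω i) → 𝕜} (h : f =ᵐ[Measure.pi μ] g) :
    weightedMixedENorm μ P w f = weightedMixedENorm μ P w g :=
  le_antisymm (weightedMixedENorm_mono_ae (h.mono fun x hx => by rw [hx]))
    (weightedMixedENorm_mono_ae (h.mono fun x hx => by rw [hx]))

lemma weightedMixedENorm_lt_top_of_bound (hw : weightedMixedENorm μ P w (fun _ => (1 : 𝕜)) < ∞)
    {f : (∀ i, Ω i) → 𝕜} (C : ℝ) (hf : ∀ x, ‖f x‖ ≤ C) : weightedMixedENorm μ P w f < ∞ := by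
  refine lt_of_le_of_lt (le_trans (mixedENorm_mono_ae μ P (ae_of_all _ fun x => ?_))
    (mixedENorm_const_mul_le μ P C.toNNReal fun x => ‖(1 : 𝕜)‖ₑ * ENNReal.ofReal (w x)))
    (ENNReal.mul_lt_top ENNReal.coe_lt_top hw)
  rw [enorm_one, one_mul]
  gcongr
  rw [← ofReal_norm]
  exact ENNReal.ofReal_le_ofReal (hf x)

/-- Hölder's inequality for the weighted mixed norms. -/
lemma lintegral_enorm_mul_enorm_le (hP : ∀ i, 1 ≤ P i) (hPt : ∀ i, P i ≠ ∞)
    {f h : (∀ i, Ω i) → 𝕜} (hf : Measurable f) (hh : Measurable h) :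
    ∫⁻ x, ‖h x‖ₑ * ‖f x‖ₑ ∂Measure.pi μ ≤
      weightedMixedENorm μ (conjExponents P) w⁻¹ h * weightedMixedENorm μ P w f := by
  rw [mul_comm]
  refine le_trans (le_of_eq ?_) (lintegral_mul_le_mixedENorm_mul μ P hP hPt
    (hf.enorm.mul w.measurable_ofReal) (hh.enorm.mul w⁻¹.measurable_ofReal))
  refine lintegral_congr fun x => ?_
  rw [mul_mul_mul_comm, w.ofReal_mul_ofReal_inv, mul_one, mul_comm]

end WeightedNorm

namespace WeightedMixedLp

variable {𝕜 : Type v} [RCLike 𝕜] {n : ℕ} {Ω : Fin n → Type u} [∀ i, MeasurableSpace (Ω i)]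
  {μ : ∀ i, Measure (Ω i)} [∀ i, SigmaFinite (μ i)] {P : Fin n → ℝ≥0∞}
  [hP : ∀ i, Fact (1 ≤ P i)] {w : Weight (∀ i, Ω i)}

lemma measurable_coe (f : WeightedMixedLp 𝕜 μ P w) : Measurable (f.1 : (∀ i, Ω i) → 𝕜) :=
  f.1.stronglyMeasurable.measurable

lemma enorm_def (f : WeightedMixedLp 𝕜 μ P w) : ‖f‖ₑ = weightedMixedENorm μ P w f.1 := by
  rw [← ofReal_norm, norm_def, ENNReal.ofReal_toReal (ne_of_lt f.2)]

/-- The element of `L^P_w(μ)` given by a measurable function of finite norm. -/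
def ofFun (f : (∀ i, Ω i) → 𝕜) (hf : Measurable f) (h : weightedMixedENorm μ P w f < ∞) :
    WeightedMixedLp 𝕜 μ P w :=
  ⟨AEEqFun.mk f hf.aestronglyMeasurable,
    (weightedMixedENorm_congr_ae (AEEqFun.coeFn_mk _ _)).trans_lt h⟩

lemma coeFn_ofFun {f : (∀ i, Ω i) → 𝕜} (hf : Measurable f)
    (h : weightedMixedENorm μ P w f < ∞) :
    ((ofFun f hf h : WeightedMixedLp 𝕜 μ P w).1 : (∀ i, Ω i) → 𝕜) =ᵐ[Measure.pi μ] f :=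
  AEEqFun.coeFn_mk _ _

lemma enorm_ofFun {f : (∀ i, Ω i) → 𝕜} (hf : Measurable f)
    (h : weightedMixedENorm μ P w f < ∞) :
    ‖(ofFun f hf h : WeightedMixedLp 𝕜 μ P w)‖ₑ = weightedMixedENorm μ P w f := by
  rw [enorm_def, weightedMixedENorm_congr_ae (coeFn_ofFun hf h)]

lemma ext_ae {f g : WeightedMixedLp 𝕜 μ P w}
    (h : (f.1 : (∀ i, Ω i) → 𝕜) =ᵐ[Measure.pi μ] g.1) : f = g :=
  Subtype.ext (AEEqFun.ext h)

lemma ofFun_coe (f : WeightedMixedLp 𝕜 μ P w) : ofFun f.1 (measurable_coe f) f.2 = f :=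
  ext_ae (coeFn_ofFun _ _)

lemma coeFn_add (f g : WeightedMixedLp 𝕜 μ P w) :
    ((f + g).1 : (∀ i, Ω i) → 𝕜) =ᵐ[Measure.pi μ] f.1 + g.1 :=
  AEEqFun.coeFn_add f.1 g.1

lemma coeFn_sub (f g : WeightedMixedLp 𝕜 μ P w) :
    ((f - g).1 : (∀ i, Ω i) → 𝕜) =ᵐ[Measure.pi μ] f.1 - g.1 :=
  AEEqFun.coeFn_sub f.1 g.1

lemma coeFn_smul (c : 𝕜) (f : WeightedMixedLp 𝕜 μ P w) :
    ((c • f).1 : (∀ i, Ω i) → 𝕜) =ᵐ[Measure.pi μ] c • f.1 :=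
  AEEqFun.coeFn_smul c f.1

/-- Dominated convergence in `L^P_w(μ)` for finite exponents. -/
lemma tendsto_ofFun_of_dominated (hPt : ∀ i, P i ≠ ∞) {ι : Type*} {l : Filter ι}
    [l.IsCountablyGenerated] {F : ι → (∀ i, Ω i) → 𝕜} (hF : ∀ k, Measurable (F k))
    (hFt : ∀ k, weightedMixedENorm μ P w (F k) < ∞) {f g : (∀ i, Ω i) → 𝕜} (hf : Measurable f)
    (hft : weightedMixedENorm μ P w f < ∞) (hg : Measurable g)
    (hgt : weightedMixedENorm μ P w g < ∞) (hFg : ∀ k x, ‖F k x‖ ≤ ‖g x‖)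
    (hfg : ∀ x, ‖f x‖ ≤ ‖g x‖)
    (hlim : ∀ x, Tendsto (fun k => F k x) l (𝓝 (f x))) :
    Tendsto (fun k => (ofFun (F k) (hF k) (hFt k) : WeightedMixedLp 𝕜 μ P w)) l
      (𝓝 (ofFun f hf hft)) := by
  rw [tendsto_iff_edist_tendsto_0]
  have key : Tendsto (fun k => weightedMixedENorm μ P w (F k - f)) l (𝓝 0) := by
    refine tendsto_mixedENorm_zero_of_dominated μ P (fun i => (hP i).out) hPt
      (fun k => ((hF k).sub hf).enorm.mul w.measurable_ofReal)
      -- Both `F k` and `f` are bounded by `g`, so their difference is bounded by `2 ‖g‖`.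
      (G := fun x => (2 : NNReal) * (‖g x‖ₑ * ENNReal.ofReal (w x)))
      ((hg.enorm.mul w.measurable_ofReal).const_mul _) (fun k x => ?_) ?_
      (ae_of_all _ fun x => ?_)
    · rw [← mul_assoc]
      gcongr
      calc ‖F k x - f x‖ₑ ≤ ‖F k x‖ₑ + ‖f x‖ₑ := enorm_sub_le
        _ ≤ ‖g x‖ₑ + ‖g x‖ₑ :=
          add_le_add (enorm_le_iff_norm_le.2 (hFg k x)) (enorm_le_iff_norm_le.2 (hfg x))
        _ = _ := by
          rw [← two_mul]
          rfl
    · exact (mixedENorm_const_mul_le μ P 2 _).trans_lt (ENNReal.mul_lt_top ENNReal.coe_lt_top hgt)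
    · have h1 : Tendsto (fun k => ‖(F k - f) x‖ₑ) l (𝓝 0) :=
        tendsto_iff_edist_tendsto_0.1 (hlim x) |>.congr fun k => by
          rw [edist_eq_enorm_sub]
          rfl
      simpa using ENNReal.Tendsto.mul_const h1 (Or.inr ENNReal.ofReal_ne_top)
  refine key.congr fun k => ?_
  rw [edist_eq_enorm_sub, enorm_def]
  refine weightedMixedENorm_congr_ae ?_
  filter_upwards [coeFn_sub (ofFun (F k) (hF k) (hFt k) : WeightedMixedLp 𝕜 μ P w)
    (ofFun f hf hft), coeFn_ofFun (hF k) (hFt k), coeFn_ofFun hf hft] with x h1 h2 h3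
  rw [h1, Pi.sub_apply, Pi.sub_apply, h2, h3]

end WeightedMixedLp

/-! ### Representation of bounded functionals -/

section Duality

variable {𝕜 : Type v} [RCLike 𝕜] {n : ℕ} {Ω : Fin n → Type u} [∀ i, MeasurableSpace (Ω i)]
  {μ : ∀ i, Measure (Ω i)} [∀ i, SigmaFinite (μ i)] {P : Fin n → ℝ≥0∞}
  [hP : ∀ i, Fact (1 ≤ P i)] {w : Weight (∀ i, Ω i)}

namespace WeightedMixedLp

/-- The indicator function of a set, as an element of `L^P_w(μ)` (zero for non-measurable sets). -/
def ind (hw : weightedMixedENorm μ P w (fun _ => (1 : 𝕜)) < ∞) (A : Set (∀ i, Ω i)) :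
    WeightedMixedLp 𝕜 μ P w :=
  open scoped Classical in
  if hA : MeasurableSet A then
    ofFun (A.indicator fun _ => 1) (measurable_const.indicator hA)
      (weightedMixedENorm_lt_top_of_bound hw 1
        fun x => (norm_indicator_le_norm_self _ x).trans_eq norm_one)
  else 0

variable (hw : weightedMixedENorm μ P w (fun _ => (1 : 𝕜)) < ∞)

lemma ind_of_not_measurableSet {A : Set (∀ i, Ω i)} (hA : ¬ MeasurableSet A) :
    ind hw A = 0 := dif_neg hA

lemma coeFn_ind {A : Set (∀ i, Ω i)} (hA : MeasurableSet A) :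
    ((ind hw A).1 : (∀ i, Ω i) → 𝕜) =ᵐ[Measure.pi μ] A.indicator fun _ => 1 := by
  rw [ind, dif_pos hA]
  exact coeFn_ofFun _ _

lemma ind_eq_zero {A : Set (∀ i, Ω i)} (hA : Measure.pi μ A = 0) : ind hw A = 0 := by
  by_cases hm : MeasurableSet A
  · refine ext_ae ((coeFn_ind hw hm).trans ?_)
    exact (indicator_meas_zero hA).trans AEEqFun.coeFn_zero.symm
  · exact ind_of_not_measurableSet hw hm

lemma ind_union {A B : Set (∀ i, Ω i)} (hA : MeasurableSet A) (hB : MeasurableSet B)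
    (hAB : Disjoint A B) : ind hw (A ∪ B) = ind hw A + ind hw B := by
  refine ext_ae ?_
  filter_upwards [coeFn_ind hw hA, coeFn_ind hw hB, coeFn_ind hw (hA.union hB),
    coeFn_add (ind hw A) (ind hw B)] with x h1 h2 h3 h4
  rw [h4, Pi.add_apply, h1, h2, h3, Set.indicator_union_of_disjoint hAB]

/-- Indicators of finite partial unions are eventually constant at each point and dominated by `1`,
which has finite norm. Finiteness of the exponents is essential: in `L^∞` such indicators need not
converge. -/
lemma hasSum_ind (hPt : ∀ i, P i ≠ ∞) {A : ℕ → Set (∀ i, Ω i)} (hA : ∀ k, MeasurableSet (A k))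
    (hd : Pairwise (Function.onFun Disjoint A)) :
    HasSum (fun k => ind hw (A k)) (ind hw (⋃ k, A k)) := by
  classical
  have hm : ∀ s : Finset ℕ, MeasurableSet (⋃ k ∈ s, A k) := fun s =>
    s.measurableSet_biUnion fun k _ => hA k
  have hsum : ∀ s : Finset ℕ, ∑ k ∈ s, ind hw (A k) = ind hw (⋃ k ∈ s, A k) := by
    intro s
    induction s using Finset.induction_on with
    | empty => simpa using (ind_eq_zero hw (measure_empty (μ := Measure.pi μ))).symm
    | insert a s ha ih =>
      rw [Finset.sum_insert ha, ih, Finset.set_biUnion_insert, ind_union hw (hA a) (hm s)]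
      rw [Set.disjoint_iUnion₂_right]
      exact fun k hk => hd fun h => ha (h ▸ hk)
  have hmU : MeasurableSet (⋃ k, A k) := MeasurableSet.iUnion hA
  have hb : ∀ (s : Set (∀ i, Ω i)) x, ‖s.indicator (fun _ => (1 : 𝕜)) x‖ ≤ ‖(1 : 𝕜)‖ :=
    fun s x => norm_indicator_le_norm_self _ x
  have hfin : ∀ s : Set (∀ i, Ω i), weightedMixedENorm μ P w (s.indicator fun _ => (1 : 𝕜)) < ∞ :=
    fun s => weightedMixedENorm_lt_top_of_bound hw _ (hb s)
  have key := tendsto_ofFun_of_dominated (w := w) hPt (l := (atTop : Filter (Finset ℕ)))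
    (F := fun s => (⋃ k ∈ s, A k).indicator fun _ => (1 : 𝕜))
    (fun s => measurable_const.indicator (hm s)) (fun s => hfin _)
    (measurable_const.indicator hmU) (hfin _) (measurable_const (a := (1 : 𝕜))) hw
    (fun s => hb _) (hb _) (fun x => ?_)
  · refine (key.congr fun s => ?_).trans_eq ?_
    · rw [hsum, ind, dif_pos (hm s)]
    · rw [ind, dif_pos hmU]
  · refine tendsto_const_nhds.congr' ?_
    by_cases hx : x ∈ ⋃ k, A k
    · obtain ⟨k, hk⟩ := Set.mem_iUnion.1 hx
      filter_upwards [eventually_ge_atTop ({k} : Finset ℕ)] with s hs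
      have : x ∈ ⋃ k ∈ s, A k := Set.mem_biUnion (hs (Finset.mem_singleton_self k)) hk
      simp only [Set.indicator_of_mem hx, Set.indicator_of_mem this]
    · refine Eventually.of_forall fun s => ?_
      have : x ∉ ⋃ k ∈ s, A k := fun h => hx (Set.iUnion₂_subset_iUnion _ _ h)
      simp only [Set.indicator_of_notMem hx, Set.indicator_of_notMem this]

/-- The signed measure `A ↦ L (φ 1_A)` of a bounded functional `φ` on `L^P_w(μ)`. -/
def signedMeasureOfDual (hPt : ∀ i, P i ≠ ∞) (φ : StrongDual 𝕜 (WeightedMixedLp 𝕜 μ P w))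
    (L : 𝕜 →L[ℝ] ℝ) : SignedMeasure (∀ i, Ω i) where
  measureOf' A := L (φ (ind hw A))
  empty' := by rw [ind_eq_zero hw measure_empty, map_zero, map_zero]
  not_measurable' A hA := by rw [ind_of_not_measurableSet hw hA, map_zero, map_zero]
  m_iUnion' A hA hd := L.hasSum (φ.hasSum (hasSum_ind hw hPt hA hd))

/-- Radon–Nikodym: null sets have zero indicator class, which gives absolute continuity. The map `L`
stands for the real or imaginary part, as signed measures are real-valued. -/
lemma exists_density (hPt : ∀ i, P i ≠ ∞) (φ : StrongDual 𝕜 (WeightedMixedLp 𝕜 μ P w))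
    (L : 𝕜 →L[ℝ] ℝ) : ∃ ρ : (∀ i, Ω i) → ℝ, Measurable ρ ∧ Integrable ρ (Measure.pi μ) ∧
      ∀ A, MeasurableSet A → ∫ x in A, ρ x ∂Measure.pi μ = L (φ (ind hw A)) := by
  set s := signedMeasureOfDual hw hPt φ L
  have hs : ∀ A, s A = L (φ (ind hw A)) := fun A => rfl
  have hac : VectorMeasure.AbsolutelyContinuous s (Measure.pi μ).toENNRealVectorMeasure := by
    refine VectorMeasure.AbsolutelyContinuous.mk fun A hA h0 => ?_
    rw [Measure.toENNRealVectorMeasure_apply_measurable hA] at h0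
    rw [hs, ind_eq_zero hw h0, map_zero, map_zero]
  refine ⟨s.rnDeriv (Measure.pi μ), SignedMeasure.measurable_rnDeriv _ _,
    SignedMeasure.integrable_rnDeriv _ _, fun A hA => ?_⟩
  rw [← withDensityᵥ_apply (SignedMeasure.integrable_rnDeriv _ _) hA,
    SignedMeasure.withDensityᵥ_rnDeriv_eq s _ hac, hs]

lemma exists_density_dual (hPt : ∀ i, P i ≠ ∞) (φ : StrongDual 𝕜 (WeightedMixedLp 𝕜 μ P w)) :
    ∃ h : (∀ i, Ω i) → 𝕜, Measurable h ∧ Integrable h (Measure.pi μ) ∧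
      ∀ A, MeasurableSet A → ∫ x in A, h x ∂Measure.pi μ = φ (ind hw A) := by
  obtain ⟨ρ, hρm, hρi, hρ⟩ := exists_density hw hPt φ RCLike.reCLM
  obtain ⟨σ, hσm, hσi, hσ⟩ := exists_density hw hPt φ RCLike.imCLM
  refine ⟨fun x => (ρ x : 𝕜) + (σ x : 𝕜) * RCLike.I,
    (RCLike.measurable_ofReal.comp hρm).add ((RCLike.measurable_ofReal.comp hσm).mul_const _),
    hρi.ofReal.add (hσi.ofReal.mul_const _), fun A hA => ?_⟩
  have hρA : Integrable (fun x => (ρ x : 𝕜)) ((Measure.pi μ).restrict A) := hρi.ofReal.restrict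
  have hσA : Integrable (fun x => (σ x : 𝕜) * RCLike.I) ((Measure.pi μ).restrict A) :=
    (hσi.ofReal.mul_const _).restrict
  rw [integral_add hρA hσA, integral_mul_const, integral_ofReal, integral_ofReal, hρ A hA, hσ A hA]
  exact RCLike.re_add_im _

lemma ofFun_add {f g : (∀ i, Ω i) → 𝕜} (hf : Measurable f) (hg : Measurable g)
    (hft : weightedMixedENorm μ P w f < ∞) (hgt : weightedMixedENorm μ P w g < ∞)
    (hfg : weightedMixedENorm μ P w (f + g) < ∞) :
    (ofFun (f + g) (hf.add hg) hfg : WeightedMixedLp 𝕜 μ P w) = ofFun f hf hft + ofFun g hg hgt :=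
  rfl

/-- A functional that is integration against `h` on indicators is so on bounded functions. -/
lemma dual_apply_of_bound (hPt : ∀ i, P i ≠ ∞) (φ : StrongDual 𝕜 (WeightedMixedLp 𝕜 μ P w))
    {h : (∀ i, Ω i) → 𝕜} (hi : Integrable h (Measure.pi μ))
    (hφ : ∀ A, MeasurableSet A → ∫ x in A, h x ∂Measure.pi μ = φ (ind hw A))
    {f : (∀ i, Ω i) → 𝕜} (hf : Measurable f) (C : ℝ) (hC : ∀ x, ‖f x‖ ≤ C)
    (hft : weightedMixedENorm μ P w f < ∞) :
    φ (ofFun f hf hft) = ∫ x, h x * f x ∂Measure.pi μ := by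
  have hbound : ∀ g : SimpleFunc (∀ i, Ω i) 𝕜, weightedMixedENorm μ P w g < ∞ := fun g => by
    obtain ⟨C, hC⟩ := g.exists_forall_norm_le
    exact weightedMixedENorm_lt_top_of_bound hw C hC
  have hint : ∀ g : SimpleFunc (∀ i, Ω i) 𝕜,
      Integrable (fun x => h x * g x) (Measure.pi μ) := fun g => by
    obtain ⟨C, hC⟩ := g.exists_forall_norm_le
    exact hi.mul_bdd g.stronglyMeasurable.aestronglyMeasurable (ae_of_all _ hC)
  have hsimple : ∀ g : SimpleFunc (∀ i, Ω i) 𝕜,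
      φ (ofFun g g.measurable (hbound g)) = ∫ x, h x * g x ∂Measure.pi μ := by
    intro g
    induction g using SimpleFunc.induction with
    | const c hA =>
      rename_i A
      have h1 : ofFun _ (SimpleFunc.measurable _) (hbound (SimpleFunc.piecewise A hA
          (SimpleFunc.const _ c) (SimpleFunc.const _ 0))) = c • ind hw A := by
        refine ext_ae ?_
        filter_upwards [coeFn_ofFun (SimpleFunc.measurable _) (hbound (SimpleFunc.piecewise A hA
          (SimpleFunc.const _ c) (SimpleFunc.const _ 0))), coeFn_smul c (ind hw A),
          coeFn_ind hw hA] with x h1 h2 h3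
        rw [h1, h2, Pi.smul_apply, h3]
        by_cases hx : x ∈ A <;> simp [hx]
      rw [h1, map_smul, ← hφ A hA, smul_eq_mul, ← integral_const_mul, ← integral_indicator hA]
      refine integral_congr_ae (ae_of_all _ fun x => ?_)
      by_cases hx : x ∈ A <;> simp [hx, mul_comm]
    | add hd ihf ihg =>
      rename_i f g
      have h1 := ofFun_add f.measurable g.measurable (hbound f) (hbound g) (hbound (f + g))
      calc φ (ofFun (f + g : SimpleFunc (∀ i, Ω i) 𝕜) (SimpleFunc.measurable _) (hbound (f + g)))
          = φ (ofFun f f.measurable (hbound f) + ofFun g g.measurable (hbound g)) :=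
            congrArg φ h1
        _ = _ := by
          rw [map_add, ihf, ihg, ← integral_add (hint f) (hint g)]
          refine integral_congr_ae (ae_of_all _ fun x => ?_)
          simp [mul_add]
  have hfs : StronglyMeasurable f := hf.stronglyMeasurable
  have hCC : ∀ x, ‖f x‖ ≤ ‖((|C| : ℝ) : 𝕜)‖ := fun x => by
    rw [RCLike.norm_ofReal, abs_abs]
    exact (hC x).trans (le_abs_self C)
  have hab : ∀ k x, ‖hfs.approxBounded |C| k x‖ ≤ |C| :=
    fun k x => hfs.norm_approxBounded_le (abs_nonneg C) k x
  have hlim : ∀ x, Tendsto (fun k => hfs.approxBounded |C| k x) atTop (𝓝 (f x)) := fun x =>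
    hfs.tendsto_approxBounded_of_norm_le ((hC x).trans (le_abs_self C))
  -- Simple functions bounded by `|C|` approximate `f`. The left side passes to the limit in
  -- `L^P_w`, the right side because `h` is integrable.
  have h1 := tendsto_ofFun_of_dominated hPt (fun k => (hfs.approxBounded |C| k).measurable)
    (fun k => hbound _) hf hft (measurable_const (a := ((|C| : ℝ) : 𝕜)))
    (weightedMixedENorm_lt_top_of_bound hw |C| (fun x => by
      rw [RCLike.norm_ofReal, abs_abs]))
    (fun k x => by
      rw [RCLike.norm_ofReal, abs_abs]
      exact hab k x) hCC hlim
  have h2 : Tendsto (fun k => ∫ x, h x * hfs.approxBounded |C| k x ∂Measure.pi μ) atTop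
      (𝓝 (∫ x, h x * f x ∂Measure.pi μ)) := by
    refine tendsto_integral_of_dominated_convergence (fun x => ‖h x‖ * |C|)
      (fun k => (hint _).aestronglyMeasurable) (hi.norm.mul_const _)
      (fun k => ae_of_all _ fun x => ?_) (ae_of_all _ fun x => (hlim x).const_mul _)
    rw [norm_mul]
    gcongr
    exact hab k x
  refine tendsto_nhds_unique ((φ.continuous.tendsto _).comp h1) (h2.congr fun k => ?_)
  exact (hsimple _).symm

/-- Evaluate `φ` at the truncation of `u` multiplied by the conjugate phase of `h`: the integrand
becomes `‖h‖ min(u, k)`. Boundedness makes the integral formula available, and monotone convergence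
removes the truncation. -/
lemma lintegral_enorm_mul_le_of_dual (hPt : ∀ i, P i ≠ ∞)
    (φ : StrongDual 𝕜 (WeightedMixedLp 𝕜 μ P w))
    {h : (∀ i, Ω i) → 𝕜} (hm : Measurable h) (hi : Integrable h (Measure.pi μ))
    (hφ : ∀ A, MeasurableSet A → ∫ x in A, h x ∂Measure.pi μ = φ (ind hw A))
    {u : (∀ i, Ω i) → ℝ≥0∞} (hu : Measurable u) :
    ∫⁻ x, ‖h x‖ₑ * u x ∂Measure.pi μ ≤
      ‖φ‖ₑ * mixedENorm μ P fun x => u x * ENNReal.ofReal (w x) := by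
  have hsup : ∀ x, ‖h x‖ₑ * u x = ⨆ k : ℕ, ‖h x‖ₑ * min (u x) k := fun x => by
    rw [← ENNReal.mul_iSup, ← inf_iSup_eq, ENNReal.iSup_natCast, inf_top_eq]
  simp only [hsup]
  rw [lintegral_iSup (f := fun (k : ℕ) x => ‖h x‖ₑ * min (u x) k)
    (fun k => hm.enorm.mul (hu.min measurable_const)) fun i j hij x => by
    have : (i : ℝ≥0∞) ≤ j := by exact_mod_cast hij
    dsimp only
    gcongr]
  refine iSup_le fun k => ?_
  let v : (∀ i, Ω i) → ℝ := fun x => (min (u x) k).toReal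
  have hfin : ∀ x, min (u x) (k : ℝ≥0∞) ≠ ∞ := fun x =>
    ((min_le_right _ _).trans_lt (ENNReal.natCast_lt_top k)).ne
  have hv : Measurable v := (hu.min measurable_const).ennreal_toReal
  have hvk : ∀ x, v x ≤ k := fun x => by
    have := ENNReal.toReal_mono (ENNReal.natCast_ne_top k) (min_le_right (u x) k)
    simpa using this
  have hv0 : ∀ x, 0 ≤ v x := fun x => ENNReal.toReal_nonneg
  -- Where `h` vanishes, so does `f`, since `0⁻¹ = 0`; the product `h f` is unaffected.
  let f : (∀ i, Ω i) → 𝕜 := fun x => (v x : 𝕜) * ((starRingEnd 𝕜) (h x) * (‖h x‖⁻¹ : ℝ))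
  have hstar : Measurable fun x => (starRingEnd 𝕜) (h x) :=
    RCLike.continuous_conj.measurable.comp hm
  have hf : Measurable f := (RCLike.measurable_ofReal.comp hv).mul
    (hstar.mul (RCLike.measurable_ofReal.comp hm.norm.inv))
  have hfv : ∀ x, ‖f x‖ ≤ v x := fun x => by
    simp only [f, norm_mul, RCLike.norm_ofReal, RCLike.norm_conj, abs_of_nonneg (hv0 x),
      abs_inv, abs_norm]
    exact mul_le_of_le_one_right (hv0 x) (mul_inv_le_one)
  have hfk : ∀ x, ‖f x‖ ≤ k := fun x => (hfv x).trans (hvk x)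
  have hft := weightedMixedENorm_lt_top_of_bound (w := w) hw k hfk
  have happ := dual_apply_of_bound hw hPt φ hi hφ hf k hfk hft
  have hhf : ∀ x, h x * f x = ((‖h x‖ * v x : ℝ) : 𝕜) := fun x => by
    rcases eq_or_ne (h x) 0 with h0 | h0
    · simp [h0]
    have h1 : ((‖h x‖ : ℝ) : 𝕜) ≠ 0 := by exact_mod_cast norm_ne_zero_iff.2 h0
    simp only [f]
    calc h x * ((v x : 𝕜) * ((starRingEnd 𝕜) (h x) * (‖h x‖⁻¹ : ℝ)))
        = (h x * (starRingEnd 𝕜) (h x)) * ((‖h x‖⁻¹ : ℝ) : 𝕜) * (v x : 𝕜) := by ring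
      _ = _ := by
        rw [RCLike.mul_conj]
        push_cast
        field_simp
  have hlhs : ∫⁻ x, ‖h x‖ₑ * min (u x) k ∂Measure.pi μ = ‖φ (ofFun f hf hft)‖ₑ := by
    have hint : Integrable (fun x => ‖h x‖ * v x) (Measure.pi μ) :=
      hi.norm.mul_bdd hv.aestronglyMeasurable (ae_of_all _ fun x => by
        rw [Real.norm_of_nonneg (hv0 x)]
        exact hvk x)
    have hnn : ∀ x, 0 ≤ ‖h x‖ * v x := fun x => mul_nonneg (norm_nonneg _) (hv0 x)
    rw [happ]
    simp only [hhf]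
    rw [integral_ofReal, ← ofReal_norm, RCLike.norm_ofReal,
      abs_of_nonneg (integral_nonneg hnn),
      ofReal_integral_eq_lintegral_ofReal hint (ae_of_all _ hnn)]
    refine lintegral_congr fun x => ?_
    rw [ENNReal.ofReal_mul (norm_nonneg _), ofReal_norm, ENNReal.ofReal_toReal (hfin x)]
  rw [hlhs]
  refine (φ.le_opENorm _).trans ?_
  rw [enorm_ofFun]
  gcongr
  refine mixedENorm_mono_ae μ P (ae_of_all _ fun x => ?_)
  gcongr
  rw [← ofReal_norm]
  calc ENNReal.ofReal ‖f x‖ ≤ ENNReal.ofReal (v x) := ENNReal.ofReal_le_ofReal (hfv x)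
    _ = min (u x) k := ENNReal.ofReal_toReal (hfin x)
    _ ≤ u x := min_le_left _ _

lemma integrable_mul_coe (hPt : ∀ i, P i ≠ ∞) (h : WeightedMixedLp 𝕜 μ (conjExponents P) w⁻¹)
    (f : WeightedMixedLp 𝕜 μ P w) : Integrable (fun x => h.1 x * f.1 x) (Measure.pi μ) := by
  refine ⟨((measurable_coe h).mul (measurable_coe f)).aestronglyMeasurable, ?_⟩
  simp only [HasFiniteIntegral, enorm_mul]
  exact (lintegral_enorm_mul_enorm_le (w := w) (fun i => (hP i).out) hPt (measurable_coe f)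
    (measurable_coe h)).trans_lt (ENNReal.mul_lt_top h.2 f.2)

/-- Every bounded functional on `L^P_w(μ)`, for finite exponents and `1 ∈ L^P_w(μ)`, is integration
against a function in `L^{P'}_{w⁻¹}(μ)` of no larger norm. -/
theorem exists_dual_representation
    (hw : weightedMixedENorm μ P w (fun _ => (1 : 𝕜)) < ∞) (hPt : ∀ i, P i ≠ ∞)
    (φ : StrongDual 𝕜 (WeightedMixedLp 𝕜 μ P w)) :
    ∃ h : WeightedMixedLp 𝕜 μ (conjExponents P) w⁻¹, ‖h‖ ≤ ‖φ‖ ∧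
      ∀ f : WeightedMixedLp 𝕜 μ P w, φ f = ∫ x, h.1 x * f.1 x ∂Measure.pi μ := by
  obtain ⟨h, hm, hi, hφ⟩ := exists_density_dual hw hPt φ
  have hnorm : weightedMixedENorm μ (conjExponents P) w⁻¹ h ≤ ‖φ‖ₑ := by
    refine mixedENorm_conjExponents_le μ P (fun i => (hP i).out) hPt
      (hm.enorm.mul w⁻¹.measurable_ofReal) _ fun u hu => ?_
    -- Replacing the test function `u` by `w⁻¹ u` moves the weight onto `h` and cancels `w` in the
    -- norm.
    have := lintegral_enorm_mul_le_of_dual hw hPt φ hm hi hφ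
      (u := fun x => ENNReal.ofReal (w⁻¹ x) * u x) (w⁻¹.measurable_ofReal.mul hu)
    refine le_trans (le_of_eq ?_) (this.trans (le_of_eq ?_))
    · simp only [Pi.mul_apply, mul_assoc]
    · congr 2
      funext x
      rw [mul_right_comm, mul_comm (ENNReal.ofReal (w⁻¹ x)), w.ofReal_mul_ofReal_inv, one_mul]
  let H : WeightedMixedLp 𝕜 μ (conjExponents P) w⁻¹ :=
    ofFun h hm (hnorm.trans_lt enorm_lt_top)
  have hH : (H.1 : (∀ i, Ω i) → 𝕜) =ᵐ[Measure.pi μ] h := coeFn_ofFun _ _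
  refine ⟨H, enorm_le_iff_norm_le.1 ((enorm_ofFun _ _).trans_le hnorm), fun f => ?_⟩
  -- The formula is known for bounded functions. Since `h` now has finite dual norm, `h f` is
  -- integrable by Hölder and dominates the truncated integrands.
  let F : ℕ → (∀ i, Ω i) → 𝕜 := fun k => {x | ‖f.1 x‖ ≤ k}.indicator f.1
  have hF : ∀ k, Measurable (F k) := fun k =>
    (measurable_coe f).indicator (measurableSet_le (measurable_coe f).norm measurable_const)
  have hFf : ∀ k x, ‖F k x‖ ≤ ‖f.1 x‖ := fun k x => norm_indicator_le_norm_self _ x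
  have hFk : ∀ k x, ‖F k x‖ ≤ k := fun k x => by
    by_cases hx : ‖f.1 x‖ ≤ k
    · exact (hFf k x).trans hx
    · simp [F, hx]
  have hFt : ∀ k, weightedMixedENorm μ P w (F k) < ∞ := fun k =>
    weightedMixedENorm_lt_top_of_bound hw k (hFk k)
  have hlim : ∀ x, Tendsto (fun k => F k x) atTop (𝓝 (f.1 x)) := fun x => by
    refine tendsto_const_nhds.congr' ?_
    obtain ⟨N, hN⟩ := exists_nat_ge ‖f.1 x‖
    filter_upwards [eventually_ge_atTop N] with k hk
    have : x ∈ {x | ‖f.1 x‖ ≤ k} := hN.trans (by exact_mod_cast hk)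
    exact (Set.indicator_of_mem this _).symm
  have h1 := tendsto_ofFun_of_dominated hPt hF hFt (measurable_coe f) f.2 (measurable_coe f) f.2 hFf
    (fun x => le_rfl) hlim
  rw [ofFun_coe] at h1
  have hint : Integrable (fun x => h x * f.1 x) (Measure.pi μ) :=
    (integrable_mul_coe hPt H f).congr (hH.mono fun x hx => by simp only [hx])
  have h2 : Tendsto (fun k => ∫ x, h x * F k x ∂Measure.pi μ) atTop
      (𝓝 (∫ x, h x * f.1 x ∂Measure.pi μ)) := by
    refine tendsto_integral_of_dominated_convergence (fun x => ‖h x * f.1 x‖)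
      (fun k => (hm.mul (hF k)).aestronglyMeasurable) hint.norm
      (fun k => ae_of_all _ fun x => ?_) (ae_of_all _ fun x => (hlim x).const_mul _)
    rw [norm_mul, norm_mul]
    gcongr
    exact hFf k x
  rw [integral_congr_ae (hH.mono fun x hx => by simp only [hx] :
    (fun x => H.1 x * f.1 x) =ᵐ[Measure.pi μ] fun x => h x * f.1 x)]
  refine tendsto_nhds_unique ((φ.continuous.tendsto _).comp h1) (h2.congr fun k => ?_)
  exact (dual_apply_of_bound hw hPt φ hi hφ (hF k) k (hFk k) (hFt k)).symm

end WeightedMixedLp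

end Duality

/-! ### Convergence of the nuclear series and its kernel -/

/-- The terms `a n ^ r` tend to `0`, so eventually `a n ≤ 1`, and then `a n ≤ a n ^ r` because `r ≤
1`. -/
lemma summable_of_summable_rpow {a : ℕ → ℝ} (ha : ∀ n, 0 ≤ a n) {r : ℝ} (hr0 : 0 < r)
    (hr1 : r ≤ 1) (h : Summable fun n => a n ^ r) : Summable a := by
  refine Summable.of_norm_bounded_eventually_nat h ?_
  filter_upwards [h.tendsto_atTop_zero.eventually (ge_mem_nhds zero_lt_one)] with n hn
  have h1 : a n ≤ 1 := by
    by_contra! hlt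
    exact hn.not_gt (Real.one_lt_rpow hlt hr0)
  rw [Real.norm_of_nonneg (ha n)]
  simpa using Real.rpow_le_rpow_of_exponent_ge_of_imp (ha n) h1 hr1 fun _ h => absurd h one_ne_zero

lemma tsum_enorm_mul_enorm_ne_top {E F : Type*} [SeminormedAddCommGroup E]
    [SeminormedAddCommGroup F] {r : ℝ} (hr0 : 0 < r) (hr1 : r ≤ 1) {g : ℕ → E} {h : ℕ → F}
    (hs : Summable fun n => ‖g n‖ ^ r * ‖h n‖ ^ r) : ∑' n, ‖g n‖ₑ * ‖h n‖ₑ ≠ ∞ := by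
  have h1 : Summable fun n => ‖g n‖ * ‖h n‖ := by
    refine summable_of_summable_rpow (fun n => by positivity) hr0 hr1 (hs.congr fun n => ?_)
    rw [Real.mul_rpow (norm_nonneg _) (norm_nonneg _)]
  refine ne_of_eq_of_ne (tsum_congr fun n => ?_) h1.tsum_ofReal_ne_top
  rw [ENNReal.ofReal_mul (norm_nonneg _), ofReal_norm, ofReal_norm]

section Series

variable {𝕜 : Type*} [RCLike 𝕜] {α : Type*} [MeasurableSpace α] {μ : Measure α}

lemma ae_summable_norm_of_tsum_lintegral_ne_top {F : ℕ → α → 𝕜} (hF : ∀ n, Measurable (F n))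
    (h : ∑' n, ∫⁻ x, ‖F n x‖ₑ ∂μ ≠ ∞) : ∀ᵐ x ∂μ, Summable fun n => ‖F n x‖ := by
  rw [← lintegral_tsum fun n => (hF n).enorm.aemeasurable] at h
  filter_upwards [ae_lt_top (Measurable.tsum fun n => (hF n).enorm) h] with x hx
  exact tsum_enorm_ne_top_iff_summable_norm.1 hx.ne

lemma integrable_tsum_of_tsum_lintegral_ne_top {F : ℕ → α → 𝕜} (hF : ∀ n, Measurable (F n))
    (h : ∑' n, ∫⁻ x, ‖F n x‖ₑ ∂μ ≠ ∞) : Integrable (fun x => ∑' n, F n x) μ := by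
  refine ⟨?_, ?_⟩
  · refine aestronglyMeasurable_of_tendsto_ae atTop (f := fun N x => ∑ n ∈ Finset.range N, F n x)
      (fun N => (Finset.measurable_sum _ fun n _ => hF n).aestronglyMeasurable) ?_
    filter_upwards [ae_summable_norm_of_tsum_lintegral_ne_top hF h] with x hx
    exact hx.of_norm.hasSum.tendsto_sum_nat
  · refine lt_of_le_of_lt (lintegral_mono fun x => enorm_tsum_le_tsum_enorm) ?_
    rw [lintegral_tsum fun n => (hF n).enorm.aemeasurable]
    exact h.lt_top

end Series

namespace WeightedMixedLp

variable {𝕜 : Type*} [RCLike 𝕜] {l m : ℕ} {Ω : Fin l → Type*} [∀ i, MeasurableSpace (Ω i)]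
  {Ξ : Fin m → Type*} [∀ j, MeasurableSpace (Ξ j)]
  {μ : ∀ i, Measure (Ω i)} [∀ i, SigmaFinite (μ i)]
  {ν : ∀ j, Measure (Ξ j)} [∀ j, SigmaFinite (ν j)]
  {P : Fin l → ℝ≥0∞} [hP : ∀ i, Fact (1 ≤ P i)]
  {Q : Fin m → ℝ≥0∞} [hQ : ∀ j, Fact (1 ≤ Q j)]
  {w : Weight (∀ i, Ω i)} {w' : Weight (∀ j, Ξ j)}

/-- `L^Q_{w'}(ν)` embeds in `L¹(ν)` when `1 ∈ L^{Q'}_{w'⁻¹}(ν)`. -/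
lemma lintegral_enorm_coe_le (hQt : ∀ j, Q j ≠ ∞) (g : WeightedMixedLp 𝕜 ν Q w') :
    ∫⁻ x, ‖g.1 x‖ₑ ∂Measure.pi ν ≤
      weightedMixedENorm ν (conjExponents Q) w'⁻¹ (fun _ => (1 : 𝕜)) * ‖g‖ₑ := by
  rw [enorm_def]
  refine le_trans (le_of_eq ?_) (lintegral_enorm_mul_enorm_le (w := w') (fun j => (hQ j).out) hQt
    (measurable_coe g) (measurable_const (a := (1 : 𝕜))))
  simp

/-- Integrating over `x` gives at most `C ‖f‖ ∑ ‖gₙ‖ ‖hₙ‖`, by Hölder in `y` and the embedding into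
`L¹` in `x`; a finite integral has an a.e. finite integrand. -/
lemma ae_tsum_lintegral_ne_top (hPt : ∀ i, P i ≠ ∞) (hQt : ∀ j, Q j ≠ ∞)
    (hw' : weightedMixedENorm ν (conjExponents Q) w'⁻¹ (fun _ => (1 : 𝕜)) < ∞)
    {g : ℕ → WeightedMixedLp 𝕜 ν Q w'} {h : ℕ → WeightedMixedLp 𝕜 μ (conjExponents P) w⁻¹}
    (hs : ∑' n, ‖g n‖ₑ * ‖h n‖ₑ ≠ ∞) {f : (∀ i, Ω i) → 𝕜} (hf : Measurable f)
    (hft : weightedMixedENorm μ P w f < ∞) :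
    ∀ᵐ x ∂Measure.pi ν, ∑' n, ∫⁻ y, ‖(g n).1 x * (h n).1 y * f y‖ₑ ∂Measure.pi μ ≠ ∞ := by
  set C := weightedMixedENorm ν (conjExponents Q) w'⁻¹ (fun _ => (1 : 𝕜))
  set I : ℕ → ℝ≥0∞ := fun n => ∫⁻ y, ‖(h n).1 y‖ₑ * ‖f y‖ₑ ∂Measure.pi μ
  have hI : ∀ n, I n ≤ ‖h n‖ₑ * weightedMixedENorm μ P w f := fun n => by
    rw [enorm_def]
    exact lintegral_enorm_mul_enorm_le (fun i => (hP i).out) hPt hf (measurable_coe (h n))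
  have hgm : ∀ n, Measurable fun x => ‖(g n).1 x‖ₑ * I n := fun n =>
    (measurable_coe (g n)).enorm.mul_const _
  have hfin : ∫⁻ x, ∑' n, ‖(g n).1 x‖ₑ * I n ∂Measure.pi ν ≠ ∞ := by
    rw [lintegral_tsum fun n => (hgm n).aemeasurable]
    refine ne_top_of_le_ne_top (b := ∑' n, (‖g n‖ₑ * ‖h n‖ₑ) * (C * weightedMixedENorm μ P w f))
      ?_ (ENNReal.tsum_le_tsum fun n => ?_)
    · rw [ENNReal.tsum_mul_right]
      exact ENNReal.mul_ne_top hs (ENNReal.mul_ne_top hw'.ne hft.ne)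
    · rw [lintegral_mul_const _ (measurable_coe (g n)).enorm]
      calc _ ≤ (C * ‖g n‖ₑ) * (‖h n‖ₑ * weightedMixedENorm μ P w f) :=
            mul_le_mul' (lintegral_enorm_coe_le hQt (g n)) (hI n)
        _ = _ := by ring
  filter_upwards [ae_lt_top (Measurable.tsum hgm) hfin] with x hx
  refine ne_of_eq_of_ne (tsum_congr fun n => ?_) hx.ne
  simp only [enorm_mul, mul_assoc]
  exact lintegral_const_mul _ ((measurable_coe (h n)).enorm.mul hf.enorm)

/-- The nuclear kernels are well defined, and integrals against them can be computed termwise. -/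
lemma ae_kernel (hPt : ∀ i, P i ≠ ∞) (hQt : ∀ j, Q j ≠ ∞)
    (hw : weightedMixedENorm μ P w (fun _ => (1 : 𝕜)) < ∞)
    (hw' : weightedMixedENorm ν (conjExponents Q) w'⁻¹ (fun _ => (1 : 𝕜)) < ∞)
    {g : ℕ → WeightedMixedLp 𝕜 ν Q w'} {h : ℕ → WeightedMixedLp 𝕜 μ (conjExponents P) w⁻¹}
    (hs : ∑' n, ‖g n‖ₑ * ‖h n‖ₑ ≠ ∞) (f : WeightedMixedLp 𝕜 μ P w) :
    ∀ᵐ x ∂Measure.pi ν,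
      (∀ᵐ y ∂Measure.pi μ, Summable fun n => (g n).1 x * (h n).1 y) ∧
      Integrable (fun y => (∑' n, (g n).1 x * (h n).1 y) * f.1 y) (Measure.pi μ) ∧
      HasSum (fun n => (∫ y, (h n).1 y * f.1 y ∂Measure.pi μ) * (g n).1 x)
        (∫ y, (∑' n, (g n).1 x * (h n).1 y) * f.1 y ∂Measure.pi μ) := by
  -- Taking the constant `1` gives convergence of the kernel itself, even where `f` vanishes; taking
  -- `f` gives integrability and the termwise integral.
  filter_upwards [ae_tsum_lintegral_ne_top hPt hQt hw' hs measurable_const hw,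
    ae_tsum_lintegral_ne_top hPt hQt hw' hs (measurable_coe f) f.2] with x h1 hf
  have hFm : ∀ n, Measurable fun y => (g n).1 x * (h n).1 y * f.1 y := fun n =>
    ((measurable_coe (h n)).const_mul _).mul (measurable_coe f)
  refine ⟨?_, ?_, ?_⟩
  · filter_upwards [ae_summable_norm_of_tsum_lintegral_ne_top
      (fun n => ((measurable_coe (h n)).const_mul _).mul measurable_const) h1] with y hy
    simpa only [Pi.mul_apply, mul_one] using hy.of_norm
  · simp only [← tsum_mul_right]
    exact integrable_tsum_of_tsum_lintegral_ne_top hFm hf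
  · simp only [← tsum_mul_right]
    have hsum : Summable fun n => ∫ y, (g n).1 x * (h n).1 y * f.1 y ∂Measure.pi μ := by
      refine Summable.of_norm (tsum_enorm_ne_top_iff_summable_norm.1
        (ne_top_of_le_ne_top hf (ENNReal.tsum_le_tsum fun n =>
          enorm_integral_le_lintegral_enorm _)))
    have := hsum.hasSum
    rw [← integral_tsum (fun n => (hFm n).aestronglyMeasurable) hf] at this
    convert this using 2 with n
    simp only [mul_assoc]
    rw [integral_const_mul, mul_comm]

/-- Norm limits and almost everywhere limits in `L^Q_{w'}(ν)` agree. -/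
lemma ae_eq_of_tendsto (hQt : ∀ j, Q j ≠ ∞)
    (hw' : weightedMixedENorm ν (conjExponents Q) w'⁻¹ (fun _ => (1 : 𝕜)) < ∞)
    {S : ℕ → WeightedMixedLp 𝕜 ν Q w'} {G : WeightedMixedLp 𝕜 ν Q w'}
    (hS : Tendsto S atTop (𝓝 G)) {G' : (∀ j, Ξ j) → 𝕜}
    (hS' : ∀ᵐ x ∂Measure.pi ν, Tendsto (fun N => (S N).1 x) atTop (𝓝 (G' x))) :
    G.1 =ᵐ[Measure.pi ν] G' := by
  have h1 : Tendsto (fun N => eLpNorm ((S N).1 - G.1 : (∀ j, Ξ j) → 𝕜) 1 (Measure.pi ν)) atTop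
      (𝓝 0) := by
    have h2 := ENNReal.Tendsto.const_mul (tendsto_iff_edist_tendsto_0.1 hS) (Or.inr hw'.ne)
    rw [mul_zero] at h2
    refine tendsto_of_tendsto_of_tendsto_of_le_of_le tendsto_const_nhds h2 (fun N => zero_le)
      fun N => ?_
    dsimp only
    rw [edist_eq_enorm_sub, eLpNorm_one_eq_lintegral_enorm]
    refine le_trans (le_of_eq (lintegral_congr_ae ?_)) (lintegral_enorm_coe_le hQt (S N - G))
    filter_upwards [coeFn_sub (S N) G] with x hx
    rw [hx]
  -- Convergence in `L¹` gives a.e. convergence along a subsequence, enough because the whole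
  -- sequence already converges pointwise.
  obtain ⟨k, hk, hk'⟩ := (tendstoInMeasure_of_tendsto_eLpNorm one_ne_zero
    (fun N => (measurable_coe (S N)).aestronglyMeasurable)
    (measurable_coe G).aestronglyMeasurable h1).exists_seq_tendsto_ae
  filter_upwards [hS', hk'] with x hx hx'
  exact tendsto_nhds_unique hx' (hx.comp hk.tendsto_atTop)

lemma coeFn_sum_smul (c : ℕ → 𝕜) (g : ℕ → WeightedMixedLp 𝕜 ν Q w') (N : ℕ) :
    ((∑ n ∈ Finset.range N, c n • g n).1 : (∀ j, Ξ j) → 𝕜) =ᵐ[Measure.pi ν]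
      fun x => ∑ n ∈ Finset.range N, c n * (g n).1 x := by
  induction N with
  | zero =>
    simp only [Finset.range_zero, Finset.sum_empty]
    exact AEEqFun.coeFn_zero
  | succ N ih =>
    filter_upwards [ih, coeFn_add (∑ n ∈ Finset.range N, c n • g n) (c N • g N),
      coeFn_smul (c N) (g N)] with x h1 h2 h3
    rw [Finset.sum_range_succ, Finset.sum_range_succ, h2, Pi.add_apply, h1, h3, Pi.smul_apply,
      smul_eq_mul]

/-- An absolutely convergent series converges in norm to its almost everywhere sum. -/
lemma hasSum_of_ae_hasSum (hQt : ∀ j, Q j ≠ ∞) {c : ℕ → 𝕜} {g : ℕ → WeightedMixedLp 𝕜 ν Q w'}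
    (hs : ∑' n, ‖c n‖ₑ * ‖g n‖ₑ ≠ ∞) {G : WeightedMixedLp 𝕜 ν Q w'}
    (hG : ∀ᵐ x ∂Measure.pi ν, HasSum (fun n => c n * (g n).1 x) (G.1 x)) :
    HasSum (fun n => c n • g n) G := by
  have hs' : Summable fun n => ‖c n • g n‖ :=
    tsum_enorm_ne_top_iff_summable_norm.1 (by simpa only [enorm_smul] using hs)
  rw [hasSum_iff_tendsto_nat_of_summable_norm hs', tendsto_iff_edist_tendsto_0]
  -- The distance to the `N`-th partial sum is bounded by the tail of a convergent numerical series.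
  -- Completeness plays no role, since the limit `G` is given in the space.
  refine tendsto_of_tendsto_of_tendsto_of_le_of_le tendsto_const_nhds
    (ENNReal.tendsto_sum_nat_add _ hs) (fun N => zero_le) fun N => ?_
  dsimp only
  rw [edist_comm, edist_eq_enorm_sub, enorm_def]
  let a : ℕ → (∀ j, Ξ j) → ℝ≥0∞ := fun n x =>
    ‖c (n + N)‖₊ * (‖(g (n + N)).1 x‖ₑ * ENNReal.ofReal (w' x))
  have ham : ∀ n, Measurable (a n) := fun n =>
    (((measurable_coe (g (n + N))).enorm.mul w'.measurable_ofReal)).const_mul _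
  calc weightedMixedENorm ν Q w' (G - ∑ n ∈ Finset.range N, c n • g n).1
      ≤ mixedENorm ν Q (fun x => ∑' n, a n x) := by
        refine mixedENorm_mono_ae ν Q ?_
        filter_upwards [hG, coeFn_sub G (∑ n ∈ Finset.range N, c n • g n), coeFn_sum_smul c g N]
          with x h1 h2 h3
        have h4 : G.1 x - ∑ n ∈ Finset.range N, c n * (g n).1 x =
            ∑' n, c (n + N) * (g (n + N)).1 x := by
          rw [← h1.tsum_eq, ← h1.summable.sum_add_tsum_nat_add N, add_sub_cancel_left]
        rw [h2, Pi.sub_apply, h3, h4]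
        simp only [a, ← mul_assoc]
        rw [ENNReal.tsum_mul_right]
        gcongr
        refine enorm_tsum_le_tsum_enorm.trans_eq (tsum_congr fun n => ?_)
        rw [enorm_mul]
        rfl
    _ ≤ ∑' n, mixedENorm ν Q (a n) :=
        mixedENorm_tsum_le ν Q (fun j => (hQ j).out) hQt ham
    _ ≤ ∑' n, ‖c (n + N)‖ₑ * ‖g (n + N)‖ₑ := by
        refine ENNReal.tsum_le_tsum fun n => ?_
        rw [enorm_def]
        exact mixedENorm_const_mul_le ν Q _ _

/-- Integration against an element of `L^{P'}_{w⁻¹}(μ)`, as a bounded functional. -/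
def toDual (hPt : ∀ i, P i ≠ ∞) (h : WeightedMixedLp 𝕜 μ (conjExponents P) w⁻¹) :
    StrongDual 𝕜 (WeightedMixedLp 𝕜 μ P w) :=
  LinearMap.mkContinuous
    { toFun := fun f => ∫ y, h.1 y * f.1 y ∂Measure.pi μ
      map_add' := fun f g => by
        rw [← integral_add (integrable_mul_coe hPt h f) (integrable_mul_coe hPt h g)]
        refine integral_congr_ae ?_
        filter_upwards [coeFn_add f g] with x hx
        rw [hx, Pi.add_apply, mul_add]
      map_smul' := fun c f => by
        rw [RingHom.id_apply, smul_eq_mul, ← integral_const_mul]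
        refine integral_congr_ae ?_
        filter_upwards [coeFn_smul c f] with x hx
        rw [hx, Pi.smul_apply, smul_eq_mul, mul_left_comm] }
    ‖h‖ fun f => by
      change ‖∫ y, h.1 y * f.1 y ∂Measure.pi μ‖ ≤ _
      rw [← norm_norm h, ← norm_norm f, ← norm_mul, ← enorm_le_iff_norm_le, enorm_mul, enorm_norm,
        enorm_norm, enorm_def, enorm_def]
      refine (enorm_integral_le_lintegral_enorm _).trans ?_
      simp only [enorm_mul]
      exact lintegral_enorm_mul_enorm_le (fun i => (hP i).out) hPt (measurable_coe f)
        (measurable_coe h)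

lemma norm_toDual_le (hPt : ∀ i, P i ≠ ∞) (h : WeightedMixedLp 𝕜 μ (conjExponents P) w⁻¹) :
    ‖toDual hPt h‖ ≤ ‖h‖ :=
  LinearMap.mkContinuous_norm_le _ (norm_nonneg _) _

end WeightedMixedLp

open WeightedMixedLp

/-! ### The characterisation of `r`-nuclear operators -/

theorem theorem4p3 {𝕜 : Type*} [RCLike 𝕜] {r : ℝ} (hr0 : 0 < r) (hr1 : r ≤ 1)
    {l m : ℕ} {Ω : Fin l → Type*} [∀ i, MeasurableSpace (Ω i)]
    {Ξ : Fin m → Type*} [∀ j, MeasurableSpace (Ξ j)]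
    (μ : ∀ i, Measure (Ω i)) [∀ i, SigmaFinite (μ i)]
    (ν : ∀ j, Measure (Ξ j)) [∀ j, SigmaFinite (ν j)]
    (P : Fin l → ℝ≥0∞) [∀ i, Fact (1 ≤ P i)] (hP : ∀ i, P i ≠ ∞)
    (Q : Fin m → ℝ≥0∞) [∀ j, Fact (1 ≤ Q j)] (hQ : ∀ j, Q j ≠ ∞)
    (w : Weight (∀ i, Ω i)) (w' : Weight (∀ j, Ξ j))
    (hw : weightedMixedENorm μ P w (fun _ => (1 : 𝕜)) < ∞)
    (hw' : weightedMixedENorm ν (conjExponents Q) w'⁻¹ (fun _ => (1 : 𝕜)) < ∞) :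
    -- the kernels are well defined, and the integrals against them converge
    (∀ (g : ℕ → WeightedMixedLp 𝕜 ν Q w') (h : ℕ → WeightedMixedLp 𝕜 μ (conjExponents P) w⁻¹),
      Summable (fun n => ‖g n‖ ^ r * ‖h n‖ ^ r) →
      ∀ f : WeightedMixedLp 𝕜 μ P w, ∀ᵐ x ∂Measure.pi ν,
        (∀ᵐ y ∂Measure.pi μ, Summable (fun n => (g n).1 x * (h n).1 y)) ∧
        Integrable (fun y => (∑' n, (g n).1 x * (h n).1 y) * f.1 y) (Measure.pi μ)) ∧
    -- the characterisation
    ∀ T : WeightedMixedLp 𝕜 μ P w →ₗ[𝕜] WeightedMixedLp 𝕜 ν Q w',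
      IsRNuclear r T ↔
        ∃ (g : ℕ → WeightedMixedLp 𝕜 ν Q w') (h : ℕ → WeightedMixedLp 𝕜 μ (conjExponents P) w⁻¹),
          Summable (fun n => ‖g n‖ ^ r * ‖h n‖ ^ r) ∧
          ∀ f : WeightedMixedLp 𝕜 μ P w, ∀ᵐ x ∂Measure.pi ν,
            (T f).1 x = ∫ y, (∑' n, (g n).1 x * (h n).1 y) * f.1 y ∂Measure.pi μ := by
  refine ⟨fun g h hs f => ?_, fun T => ⟨?_, ?_⟩⟩
  · filter_upwards [ae_kernel hP hQ hw hw' (tsum_enorm_mul_enorm_ne_top hr0 hr1 hs) f] with x hx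
    exact ⟨hx.1, hx.2.1⟩
  · rintro ⟨φ, g, hs, hT⟩
    choose h hh hφ using fun n => exists_dual_representation hw hP (φ n)
    have hs' : Summable fun n => ‖g n‖ ^ r * ‖h n‖ ^ r := by
      refine Summable.of_nonneg_of_le (fun n => by positivity) (fun n => ?_) hs
      rw [mul_comm]
      gcongr
      exact hh n
    refine ⟨g, h, hs', fun f => ?_⟩
    -- The partial sums converge to `T f` in norm and to the kernel integral almost everywhere, so
    -- the two agree.
    refine ae_eq_of_tendsto hQ hw' (hT f).tendsto_sum_nat ?_
    filter_upwards [ae_kernel hP hQ hw hw' (tsum_enorm_mul_enorm_ne_top hr0 hr1 hs') f,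
      ae_all_iff.2 fun N => coeFn_sum_smul (fun n => φ n f) g N] with x hx hx'
    refine hx.2.2.tendsto_sum_nat.congr fun N => ?_
    rw [hx' N]
    exact Finset.sum_congr rfl fun n _ => by rw [hφ]
  · rintro ⟨g, h, hs, hT⟩
    refine ⟨fun n => toDual hP (h n), g, ?_, fun f => ?_⟩
    · refine Summable.of_nonneg_of_le (fun n => by positivity) (fun n => ?_) hs
      rw [mul_comm]
      gcongr
      exact norm_toDual_le hP (h n)
    · have hfin := tsum_enorm_mul_enorm_ne_top hr0 hr1 hs
      -- Termwise integration of the kernel makes the series sum to `T f` almost everywhere;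
      -- absolute convergence of the norms turns this into convergence in `L^Q_{w'}`.
      refine hasSum_of_ae_hasSum hQ (ne_top_of_le_ne_top
        (b := ∑' n, (‖g n‖ₑ * ‖h n‖ₑ) * ‖f‖ₑ) ?_ (ENNReal.tsum_le_tsum fun n => ?_)) ?_
      · rw [ENNReal.tsum_mul_right]
        exact ENNReal.mul_ne_top hfin enorm_ne_top
      · calc ‖toDual hP (h n) f‖ₑ * ‖g n‖ₑ ≤ (‖h n‖ₑ * ‖f‖ₑ) * ‖g n‖ₑ := by
              gcongr
              refine ((toDual hP (h n)).le_opENorm f).trans ?_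
              gcongr
              exact enorm_le_iff_norm_le.2 (norm_toDual_le hP (h n))
          _ = _ := by ring
      · filter_upwards [hT f, ae_kernel hP hQ hw hw' hfin f] with x hx hx'
        rw [hx]
        exact hx'.2.2

end
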